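/- Let $\mathsf k$ be an algebraically closed field of characteristic $0$, let $m,n\ge 1$, and let $A_n$ be the $n$-th Weyl algebra over $\mathsf k$, generated by $x_1,\dots,x_n,\partial_1,\dots,\partial_n$ with $x_ix_j=x_jx_i$, $\partial_i\partial_j=\partial_j\partial_i$, $\partial_ix_j-x_j\partial_i=\delta_{ij}$. Put $t_i=\partial_ix_i$. Let $G_m$ be the group of $m$-th roots of unity of $\mathsf k$. The symmetric group $S_n$ acts on $A_n$ by $x_i\mapsto x_{\pi(i)}$, $\partial_i\mapsto\partial_{\pi(i)}$; the group $G_m^{\otimes n}$ (the product of $n$ copies of $G_m$) acts by $x_i\mapsto\zeta_i^{-1}x_i$, $\partial_i\mapsto\zeta_i\partial_i$; together they give an action of $G(m,1,n)=G_m^{\otimes n}\rtimes S_n$. The alternating group $\mathcal A_n\subset S_n$ acts by restriction. Let $L=\mathsf k(t_1,\dots,t_n)$ and let $\sigma_i\in\mathrm{Aut}_{\mathsf k}(L)$ be given by $\sigma_i(t_j)=t_j-\delta_{ij}$. For $r\ge 1$ let $\mathcal M_r\cong\mathbb Z^n$ be the subgroup of $\mathrm{Aut}_{\mathsf k}(L)$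 generated by $\sigma_1^r,\dots,\sigma_n^r$. In the skew group ring $L*\mathcal M_r$ one has $(am)(bm')=a\,m(b)\,mm'$, and a subgroup $G\subset \mathrm{Aut}_{\mathsf k}(L)$ that normalizes $\mathcal M_r$ acts on it by $g(am)=g(a)\,gmg^{-1}$. Definitions. (a) A commutative subalgebra $\Gamma$ of an algebra $U$ is a Harish-Chandra subalgebra if $\Gamma u\Gamma$ is finitely generated as a left and as a right $\Gamma$-module for every $u\in U$. (b) Let $\Gamma\subset L$ be a subalgebra with field of fractions $K$ such that $L/K$ is a finite Galois extension with group $G$, where $G$ normalizes a submonoid $\mathcal M\subset\mathrm{Aut}_{\mathsf k}(L)$ whose elements are determined by their restrictions to $K$. A subalgebra $U$ with $\Gamma\subset U\subset(L*\mathcal M)^G$ is a Galois ring over $\Gamma$ in $(L*\mathcal M)^G$ if it is generated as a ring by $\Gamma$ and finitely many elements and $KU=UK=(L*\mathcal M)^G$. It is a Galois order over $\Gamma$ if moreover, for every finite-dimensional left (respectively right) $K$-subspace $V\subset(L*\mathcal M)^G$, the intersection $V\cap U$ is a finitely generated left (respectively right) $\Gamma$-module. Theorem. The assignment $x_i\mapsto\sigma_i$,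 $\partial_i\mapsto t_i\sigma_i^{-1}$ defines an injective homomorphism $A_n\to L*\mathcal M_1$. Let $W$ be one of the groups $G(m,1,n)$, $\mathcal A_n$, $G_m^{\otimes n}$. Then $\Gamma=\mathsf k[t_1,\dots,t_n]^W$ is a Harish-Chandra subalgebra of $A_n^W$, and, under this embedding, $A_n^W$ is a Galois order over $\Gamma$ in the invariant skew group ring - $(L*\mathcal M_m)^{S_n}$ if $W=G(m,1,n)$; - $(L*\mathcal M_1)^{\mathcal A_n}$ if $W=\mathcal A_n$; - $L*\mathcal M_m$ if $W=G_m^{\otimes n}$; where $S_n$ and $\mathcal A_n$ act on $L$ by permuting $t_1,\dots,t_n$. -/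

import Mathlib

noncomputable section

/-! ### One-sided finite generation and Harish-Chandra subalgebras -/

section FG

variable {k A : Type*} [Field k] [Ring A] [Algebra k A]

/-- The subspace `V` of `A` is a finitely generated left `R`-submodule: `V = R T` with `T` finite. -/
def LeftFG (R : Subalgebra k A) (V : Submodule k A) : Prop :=
  ∃ T : Finset A, V = Subalgebra.toSubmodule R * Submodule.span k (T : Set A)

/-- The subspace `V` of `A` is a finitely generated right `R`-submodule: `V = T R` with `T` finite. -/
def RightFG (R : Subalgebra k A) (V : Submodule k A) : Prop :=
  ∃ T : Finset A, V = Submodule.span k (T : Set A) * Subalgebra.toSubmodule R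

/-- `Γ` is a Harish-Chandra subalgebra of the subalgebra `U` of `A`: it is commutative, and `Γ u Γ`
is a finitely generated left and right `Γ`-module for every `u` in `U`. -/
structure IsHarishChandra (Γ U : Subalgebra k A) : Prop where
  le : Γ ≤ U
  comm : ∀ a ∈ Γ, ∀ b ∈ Γ, a * b = b * a
  left : ∀ u ∈ U, LeftFG Γ
    (Subalgebra.toSubmodule Γ * Submodule.span k {u} * Subalgebra.toSubmodule Γ)
  right : ∀ u ∈ U, RightFG Γ
    (Subalgebra.toSubmodule Γ * Submodule.span k {u} * Subalgebra.toSubmodule Γ)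

end FG

/-! ### Skew monoid rings, Galois rings and Galois orders -/

section Galois

variable (k L : Type*) [Field k] [Field L] [Algebra k L]

/-- The skew group ring `L * Aut_k(L)`, with `(r g) (s h) = (r g(s)) (g h)`. The skew monoid ring
`L * M` of a submonoid `M` of `Aut_k(L)` is the subalgebra of the elements supported on `M`. -/
abbrev SkewAut : Type _ := SkewMonoidAlgebra L (L ≃ₐ[k] L)

/-- The inclusion of `L` into the skew group ring as the coefficients of the identity. -/
def skewCoeff : L →ₐ[k] SkewAut k L where
  __ := SkewMonoidAlgebra.singleOneRingHom
  commutes' _ := rfl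

variable {k L}

/-- The skew monoid ring `L * M`. -/
def skewMonoidRing (M : Submonoid (L ≃ₐ[k] L)) : Subalgebra k (SkewAut k L) where
  carrier := {x | ∀ g ∈ x.support, g ∈ M}
  mul_mem' := by
    classical
    intro a b ha hb g hg
    obtain ⟨g₁, h₁, g₂, h₂, rfl⟩ := Finset.mem_mul.1 (SkewMonoidAlgebra.support_mul a b hg)
    exact M.mul_mem (ha _ h₁) (hb _ h₂)
  add_mem' := by
    classical
    intro a b ha hb g hg
    rcases Finset.mem_union.1 (SkewMonoidAlgebra.support_add hg) with h | h
    · exact ha _ h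
    · exact hb _ h
  algebraMap_mem' := by
    intro r g hg
    have h : g ∈ (SkewMonoidAlgebra.single (1 : L ≃ₐ[k] L) (algebraMap k L r)).support := hg
    have h' := SkewMonoidAlgebra.support_single_subset h
    rw [Finset.mem_singleton] at h'
    exact h' ▸ M.one_mem

/-- The automorphism `r m ↦ g(r) (g m g⁻¹)` of the skew group ring given by `g` in `Aut_k(L)`;
it is realized as conjugation by `g`, see `skewConj_single`. -/
def skewConj (g : L ≃ₐ[k] L) : SkewAut k L →ₐ[k] SkewAut k L where
  toFun x := SkewMonoidAlgebra.single g 1 * x * SkewMonoidAlgebra.single g⁻¹ 1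
  map_one' := by simp
  map_mul' x y := by
    have h : (SkewMonoidAlgebra.single g⁻¹ 1 * SkewMonoidAlgebra.single g 1 : SkewAut k L) = 1 := by
      simp
    calc _ = SkewMonoidAlgebra.single g 1 * x * 1 * y * SkewMonoidAlgebra.single g⁻¹ 1 := by
          simp only [mul_one, mul_assoc]
      _ = _ := by rw [← h]; simp only [mul_assoc]
  map_zero' := by simp
  map_add' x y := by simp [mul_add, add_mul]
  commutes' r := by
    rw [← Algebra.commutes, mul_assoc]
    simp

theorem skewConj_single (g m : L ≃ₐ[k] L) (r : L) :
    skewConj g (SkewMonoidAlgebra.single m r) =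
      SkewMonoidAlgebra.single (g * m * g⁻¹) (g r) := by
  simp [skewConj]

/-- The invariant skew monoid ring `(L * M)^G`. -/
def invSkewMonoidRing (M : Submonoid (L ≃ₐ[k] L)) (G : Subgroup (L ≃ₐ[k] L)) :
    Subalgebra k (SkewAut k L) :=
  skewMonoidRing M ⊓ ⨅ g ∈ G, AlgHom.equalizer (skewConj g) (AlgHom.id k (SkewAut k L))

/-- The field of fractions, inside `L`, of a subalgebra `Γ` of `L` (viewed in the skew ring). -/
def fracField (Γ : Subalgebra k (SkewAut k L)) : IntermediateField k L :=
  IntermediateField.adjoin k {l : L | skewCoeff k L l ∈ Γ}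

/-- The field of fractions of `Γ`, as a subalgebra of the skew ring. -/
def fracAlg (Γ : Subalgebra k (SkewAut k L)) : Subalgebra k (SkewAut k L) :=
  (fracField Γ).toSubalgebra.map (skewCoeff k L)

/-- `U` is a Galois ring over `Γ` in `(L * M)^G`. Here `K = Frac Γ`, the extension `L / K` is finite
Galois with group `G`, the group `G` acts on the monoid `M` by conjugation, and elements of `M` with
the same restriction to `K` are equal. -/
structure IsGaloisRing (M : Submonoid (L ≃ₐ[k] L)) (G : Subgroup (L ≃ₐ[k] L))
    (Γ U : Subalgebra k (SkewAut k L)) : Prop where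
  coeff : Γ ≤ (skewCoeff k L).range
  finite : FiniteDimensional (fracField Γ) L
  galois : IsGalois (fracField Γ) L
  group : G = (fracField Γ).fixingSubgroup
  conj : ∀ g ∈ G, ∀ m ∈ M, g * m * g⁻¹ ∈ M
  separating : ∀ m ∈ M, ∀ m' ∈ M, (∀ c ∈ fracField Γ, m c = m' c) → m = m'
  base_le : Γ ≤ U
  le : U ≤ invSkewMonoidRing M G
  fg : ∃ S : Finset (SkewAut k L), U = Algebra.adjoin k ((Γ : Set (SkewAut k L)) ∪ (S : Set _))
  left_span : Subalgebra.toSubmodule (fracAlg Γ) * Subalgebra.toSubmodule U =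
    Subalgebra.toSubmodule (invSkewMonoidRing M G)
  right_span : Subalgebra.toSubmodule U * Subalgebra.toSubmodule (fracAlg Γ) =
    Subalgebra.toSubmodule (invSkewMonoidRing M G)

/-- `U` is a Galois order over `Γ` in `(L * M)^G`: a Galois ring such that `V ∩ U` is a finitely
generated left (right) `Γ`-module for each finite-dimensional left (right) `Frac Γ`-subspace `V`
of `(L * M)^G`. -/
structure IsGaloisOrder (M : Submonoid (L ≃ₐ[k] L)) (G : Subgroup (L ≃ₐ[k] L))
    (Γ U : Subalgebra k (SkewAut k L)) : Prop extends IsGaloisRing M G Γ U where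
  left_order : ∀ V : Submodule k (SkewAut k L),
    V ≤ Subalgebra.toSubmodule (invSkewMonoidRing M G) → LeftFG (fracAlg Γ) V →
      LeftFG Γ (V ⊓ Subalgebra.toSubmodule U)
  right_order : ∀ V : Submodule k (SkewAut k L),
    V ≤ Subalgebra.toSubmodule (invSkewMonoidRing M G) → RightFG (fracAlg Γ) V →
      RightFG Γ (V ⊓ Subalgebra.toSubmodule U)

end Galois

/-! ### The Weyl algebra -/

section Weyl

variable (k : Type*) [Field k] (n : ℕ)

/-- The defining relations of the Weyl algebra; `Sum.inl i` stands for `x_i` and `Sum.inr i`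
for `∂_i`. -/
inductive WeylRel : FreeAlgebra k (Fin n ⊕ Fin n) → FreeAlgebra k (Fin n ⊕ Fin n) → Prop
  | x_comm (i j : Fin n) : WeylRel
      (FreeAlgebra.ι k (Sum.inl i) * FreeAlgebra.ι k (Sum.inl j))
      (FreeAlgebra.ι k (Sum.inl j) * FreeAlgebra.ι k (Sum.inl i))
  | d_comm (i j : Fin n) : WeylRel
      (FreeAlgebra.ι k (Sum.inr i) * FreeAlgebra.ι k (Sum.inr j))
      (FreeAlgebra.ι k (Sum.inr j) * FreeAlgebra.ι k (Sum.inr i))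
  | d_x (i j : Fin n) : WeylRel
      (FreeAlgebra.ι k (Sum.inr i) * FreeAlgebra.ι k (Sum.inl j) -
        FreeAlgebra.ι k (Sum.inl j) * FreeAlgebra.ι k (Sum.inr i))
      (if i = j then 1 else 0)

/-- The `n`-th Weyl algebra over `k`. -/
def WeylAlgebra : Type _ := RingQuot (WeylRel k n)

instance : Ring (WeylAlgebra k n) := inferInstanceAs (Ring (RingQuot (WeylRel k n)))

instance : Algebra k (WeylAlgebra k n) := inferInstanceAs (Algebra k (RingQuot (WeylRel k n)))

/-- The quotient map from the free algebra. -/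
def WeylAlgebra.mk : FreeAlgebra k (Fin n ⊕ Fin n) →ₐ[k] WeylAlgebra k n :=
  RingQuot.mkAlgHom k (WeylRel k n)

namespace WeylAlgebra

variable {n}

/-- The generator `x_i`. -/
def x (i : Fin n) : WeylAlgebra k n :=
  mk k n (FreeAlgebra.ι k (Sum.inl i))

/-- The generator `∂_i`. -/
def d (i : Fin n) : WeylAlgebra k n :=
  mk k n (FreeAlgebra.ι k (Sum.inr i))

/-- The element `t_i = ∂_i x_i`. -/
def t (i : Fin n) : WeylAlgebra k n := d k i * x k i

theorem mk_rel {a b : FreeAlgebra k (Fin n ⊕ Fin n)} (h : WeylRel k n a b) :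
    mk k n a = mk k n b := RingQuot.mkAlgHom_rel k h

theorem x_mul_x (i j : Fin n) : x k i * x k j = x k j * x k i := by
  simpa [x] using mk_rel k (WeylRel.x_comm (k := k) i j)

theorem d_mul_d (i j : Fin n) : d k i * d k j = d k j * d k i := by
  simpa [d] using mk_rel k (WeylRel.d_comm (k := k) i j)

theorem d_mul_x (i j : Fin n) :
    d k i * x k j - x k j * d k i = if i = j then 1 else 0 := by
  have h := mk_rel k (WeylRel.d_x (k := k) i j)
  split_ifs at h ⊢ with hij <;> simpa [d, x] using h

variable {k}

/-- The homomorphism from the Weyl algebra given by elements that satisfy its relations. -/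
def lift {B : Type*} [Ring B] [Algebra k B] (X D : Fin n → B)
    (hX : ∀ i j, X i * X j = X j * X i) (hD : ∀ i j, D i * D j = D j * D i)
    (hDX : ∀ i j, D i * X j - X j * D i = if i = j then 1 else 0) :
    WeylAlgebra k n →ₐ[k] B :=
  RingQuot.liftAlgHom k ⟨FreeAlgebra.lift k (Sum.elim X D), by
    intro a b h
    cases h with
    | x_comm i j => simpa using hX i j
    | d_comm i j => simpa using hD i j
    | d_x i j =>
      have := hDX i j
      split_ifs at this ⊢ with hij <;> simpa using this⟩

section lift

variable {B : Type*} [Ring B] [Algebra k B] (X D : Fin n → B)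
    (hX : ∀ i j, X i * X j = X j * X i) (hD : ∀ i j, D i * D j = D j * D i)
    (hDX : ∀ i j, D i * X j - X j * D i = if i = j then 1 else 0)

theorem lift_x (i : Fin n) : lift (k := k) X D hX hD hDX (x k i) = X i :=
  (RingQuot.liftAlgHom_mkAlgHom_apply _ _ _ _).trans (by simp)

theorem lift_d (i : Fin n) : lift (k := k) X D hX hD hDX (d k i) = D i :=
  (RingQuot.liftAlgHom_mkAlgHom_apply _ _ _ _).trans (by simp)

theorem hom_ext {f g : WeylAlgebra k n →ₐ[k] B} (hx : ∀ i, f (x k i) = g (x k i))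
    (hd : ∀ i, f (d k i) = g (d k i)) : f = g := by
  refine RingQuot.ringQuot_ext' (s := WeylRel k n) k f g ?_
  apply FreeAlgebra.hom_ext
  funext s
  cases s with
  | inl i => exact hx i
  | inr i => exact hd i

end lift

/-- The endomorphism `x_i ↦ (a i)⁻¹ x_i`, `∂_i ↦ (a i) ∂_i`. -/
def torusHom (a : Fin n → kˣ) : WeylAlgebra k n →ₐ[k] WeylAlgebra k n :=
  lift (fun i => (((a i)⁻¹ : kˣ) : k) • x k i) (fun i => (a i : k) • d k i)
    (fun i j => by
      simp only [smul_mul_smul_comm]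
      rw [x_mul_x, mul_comm])
    (fun i j => by
      simp only [smul_mul_smul_comm]
      rw [d_mul_d, mul_comm])
    (fun i j => by
      have h := d_mul_x k i j
      simp only [smul_mul_smul_comm]
      rw [mul_comm (((a j)⁻¹ : kˣ) : k), ← smul_sub, h]
      split_ifs with hij
      · subst hij; simp
      · simp)

theorem torusHom_x (a : Fin n → kˣ) (i : Fin n) :
    torusHom a (x k i) = (((a i)⁻¹ : kˣ) : k) • x k i := lift_x _ _ _ _ _ i

theorem torusHom_d (a : Fin n → kˣ) (i : Fin n) :
    torusHom a (d k i) = (a i : k) • d k i := lift_d _ _ _ _ _ i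

theorem torusHom_mul (a b : Fin n → kˣ) :
    torusHom (a * b) = (torusHom a).comp (torusHom b) :=
  hom_ext (fun i => by simp [torusHom_x, smul_smul, mul_comm])
    (fun i => by simp [torusHom_d, smul_smul, mul_comm])

theorem torusHom_one : torusHom (1 : Fin n → kˣ) = AlgHom.id k _ :=
  hom_ext (fun i => by simp [torusHom_x]) (fun i => by simp [torusHom_d])

/-- The action of diagonal matrices on the Weyl algebra. -/
def torusAct : (Fin n → kˣ) →* (WeylAlgebra k n ≃ₐ[k] WeylAlgebra k n) where
  toFun a := AlgEquiv.ofAlgHom (torusHom a) (torusHom a⁻¹)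
    (by rw [← torusHom_mul, mul_inv_cancel, torusHom_one])
    (by rw [← torusHom_mul, inv_mul_cancel, torusHom_one])
  map_one' := AlgEquiv.ext fun u => DFunLike.congr_fun torusHom_one u
  map_mul' a b := AlgEquiv.ext fun u => DFunLike.congr_fun (torusHom_mul a b) u

/-- The endomorphism `x_i ↦ x_{π i}`, `∂_i ↦ ∂_{π i}`. -/
def permHom (π : Equiv.Perm (Fin n)) : WeylAlgebra k n →ₐ[k] WeylAlgebra k n :=
  lift (fun i => x k (π i)) (fun i => d k (π i)) (fun _ _ => x_mul_x k _ _)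
    (fun _ _ => d_mul_d k _ _) (fun i j => by simp [d_mul_x])

theorem permHom_x (π : Equiv.Perm (Fin n)) (i : Fin n) :
    permHom π (x k i) = x k (π i) := lift_x _ _ _ _ _ i

theorem permHom_d (π : Equiv.Perm (Fin n)) (i : Fin n) :
    permHom π (d k i) = d k (π i) := lift_d _ _ _ _ _ i

theorem permHom_mul (π τ : Equiv.Perm (Fin n)) :
    permHom (k := k) (π * τ) = (permHom π).comp (permHom τ) :=
  hom_ext (fun i => by simp [permHom_x]) (fun i => by simp [permHom_d])

theorem permHom_one : permHom (1 : Equiv.Perm (Fin n)) = AlgHom.id k _ :=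
  hom_ext (fun i => by simp [permHom_x]) (fun i => by simp [permHom_d])

/-- The action of the symmetric group on the Weyl algebra. -/
def permAct : Equiv.Perm (Fin n) →* (WeylAlgebra k n ≃ₐ[k] WeylAlgebra k n) where
  toFun π := AlgEquiv.ofAlgHom (permHom π) (permHom π⁻¹)
    (by rw [← permHom_mul, mul_inv_cancel, permHom_one])
    (by rw [← permHom_mul, inv_mul_cancel, permHom_one])
  map_one' := AlgEquiv.ext fun u => DFunLike.congr_fun permHom_one u
  map_mul' a b := AlgEquiv.ext fun u => DFunLike.congr_fun (permHom_mul a b) u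

end WeylAlgebra

open WeylAlgebra

/-! ### The three groups and their actions -/

/-- The product `G_m^{⊗ n}` of `n` copies of the cyclic group of `m`-th roots of unity of `k`. -/
abbrev CyclicProduct (m : ℕ) : Type _ := Fin n → rootsOfUnity m k

/-- The group `G(m,1,n) = G_m^{⊗ n} ⋊ S_n`, where `S_n` permutes the entries. -/
abbrev ShephardTodd (m : ℕ) : Type _ :=
  CyclicProduct k n m ⋊[mulAutArrow (G := Equiv.Perm (Fin n)) (A := Fin n)
    (M := rootsOfUnity m k)] Equiv.Perm (Fin n)

/-- The action of `G_m^{⊗ n}` on the Weyl algebra: `ζ` in the `i`-th factor acts by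
`∂_i ↦ ζ ∂_i`, `x_i ↦ ζ⁻¹ x_i`, and fixes the other generators. -/
def cyclicAct (m : ℕ) : CyclicProduct k n m →* (WeylAlgebra k n ≃ₐ[k] WeylAlgebra k n) :=
  torusAct.comp ((rootsOfUnity m k).subtype.compLeft (Fin n))

/-- The action of `G(m,1,n)` on the Weyl algebra. -/
def shephardToddAct (m : ℕ) : ShephardTodd k n m →* (WeylAlgebra k n ≃ₐ[k] WeylAlgebra k n) :=
  SemidirectProduct.lift (cyclicAct k n m) permAct (by
    intro π
    apply MonoidHom.ext
    intro a
    apply AlgEquiv.coe_toAlgHom_injective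
    apply hom_ext
    · intro i
      change torusHom _ _ = permHom π (torusHom _ (permHom π⁻¹ _))
      simp [permHom_x, torusHom_x, mulAutArrow_apply_apply]
      rfl
    · intro i
      change torusHom _ _ = permHom π (torusHom _ (permHom π⁻¹ _))
      simp [permHom_d, torusHom_d, mulAutArrow_apply_apply]
      rfl)

/-- The action of the alternating group on the Weyl algebra. -/
def alternatingAct : alternatingGroup (Fin n) →* (WeylAlgebra k n ≃ₐ[k] WeylAlgebra k n) :=
  permAct.comp (alternatingGroup (Fin n)).subtype

variable {k n}

/-- The invariant subalgebra `A_n^W`. -/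
def weylInvariants {W : Type*} [Group W] (ρ : W →* (WeylAlgebra k n ≃ₐ[k] WeylAlgebra k n)) :
    Subalgebra k (WeylAlgebra k n) :=
  ⨅ w : W, AlgHom.equalizer (ρ w : WeylAlgebra k n →ₐ[k] WeylAlgebra k n) (AlgHom.id k _)

/-- The subalgebra `k[t_1, …, t_n]^W` of the Weyl algebra. -/
def tInvariants {W : Type*} [Group W] (ρ : W →* (WeylAlgebra k n ≃ₐ[k] WeylAlgebra k n)) :
    Subalgebra k (WeylAlgebra k n) :=
  Algebra.adjoin k (Set.range (t k)) ⊓ weylInvariants ρ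

variable (k n)

/-! ### The field `k(t_1, …, t_n)` and the embedding of the Weyl algebra -/

/-- The field `k(t_1, …, t_n)`. -/
abbrev RatField : Type _ := FractionRing (MvPolynomial (Fin n) k)

/-- The variable `t_i` of `k(t_1, …, t_n)`. -/
def ratVar (i : Fin n) : RatField k n := algebraMap (MvPolynomial (Fin n) k) _ (MvPolynomial.X i)

/-- The extension of automorphisms of `k[t_1, …, t_n]` to `k(t_1, …, t_n)`. -/
def ratExtend : (MvPolynomial (Fin n) k ≃ₐ[k] MvPolynomial (Fin n) k) →*
    (RatField k n ≃ₐ[k] RatField k n) :=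
  haveI : IsFractionRing k k := IsFractionRing.idem k k
  IsFractionRing.fieldEquivOfAlgEquivHom k (RatField k n)

theorem ratExtend_ratVar (f : MvPolynomial (Fin n) k ≃ₐ[k] MvPolynomial (Fin n) k) (i : Fin n) :
    ratExtend k n f (ratVar k n i) = algebraMap _ _ (f (MvPolynomial.X i)) := by
  simp [ratExtend, ratVar]

/-- The endomorphism `t_i ↦ t_i - a i` of `k[t_1, …, t_n]`. -/
def polyShiftHom (a : Fin n → ℤ) : MvPolynomial (Fin n) k →ₐ[k] MvPolynomial (Fin n) k :=
  MvPolynomial.aeval fun i => MvPolynomial.X i - MvPolynomial.C (a i : k)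

theorem polyShiftHom_add (a b : Fin n → ℤ) :
    polyShiftHom k n (a + b) = (polyShiftHom k n a).comp (polyShiftHom k n b) :=
  MvPolynomial.algHom_ext fun i => by
    simp [polyShiftHom, sub_sub]

theorem polyShiftHom_zero : polyShiftHom k n 0 = AlgHom.id k _ :=
  MvPolynomial.algHom_ext fun i => by simp [polyShiftHom]

/-- The action of `ℤ^n` on `k[t_1, …, t_n]` by shifts. -/
def polyShift :
    Multiplicative (Fin n → ℤ) →* (MvPolynomial (Fin n) k ≃ₐ[k] MvPolynomial (Fin n) k) where
  toFun a := AlgEquiv.ofAlgHom (polyShiftHom k n a.toAdd) (polyShiftHom k n (-a.toAdd))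
    (by rw [← polyShiftHom_add, add_neg_cancel, polyShiftHom_zero])
    (by rw [← polyShiftHom_add, neg_add_cancel, polyShiftHom_zero])
  map_one' := AlgEquiv.ext fun u => DFunLike.congr_fun (polyShiftHom_zero k n) u
  map_mul' a b := AlgEquiv.ext fun u =>
    DFunLike.congr_fun (polyShiftHom_add k n a.toAdd b.toAdd) u

/-- The action of `ℤ^n` on `k(t_1, …, t_n)` in which `a` sends `t_i` to `t_i - a i`. -/
def shift : Multiplicative (Fin n → ℤ) →* (RatField k n ≃ₐ[k] RatField k n) :=
  (ratExtend k n).comp (polyShift k n)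

theorem shift_ratVar (a : Multiplicative (Fin n → ℤ)) (i : Fin n) :
    shift k n a (ratVar k n i) =
      ratVar k n i - algebraMap k (RatField k n) (a.toAdd i : k) := by
  change ratExtend k n (polyShift k n a) _ = _
  rw [ratExtend_ratVar]
  change algebraMap _ _ (polyShiftHom k n a.toAdd (MvPolynomial.X i)) = _
  rw [polyShiftHom, MvPolynomial.aeval_X, map_sub,
    IsScalarTower.algebraMap_apply k (MvPolynomial (Fin n) k) (RatField k n)]
  rfl

/-- In characteristic zero `ℤ^n` acts faithfully. -/
theorem shift_injective [CharZero k] : Function.Injective (shift k n) := by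
  intro a b h
  have hi : ∀ i, a.toAdd i = b.toAdd i := by
    intro i
    have := DFunLike.congr_fun h (ratVar k n i)
    rw [shift_ratVar, shift_ratVar, sub_right_inj] at this
    exact_mod_cast (algebraMap k (RatField k n)).injective this
  exact Multiplicative.toAdd.injective (funext hi)

/-- The automorphism `σ_i` of `k(t_1, …, t_n)` with `σ_i(t_j) = t_j - δ_{ij}`. -/
def sigma (i : Fin n) : RatField k n ≃ₐ[k] RatField k n :=
  shift k n (Multiplicative.ofAdd (Pi.single i 1))

/-- The free abelian group on `σ_1^m, …, σ_n^m`, as a submonoid of `Aut_k(k(t_1, …, t_n))`. -/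
def shiftMonoid (m : ℕ) : Submonoid (RatField k n ≃ₐ[k] RatField k n) :=
  (Subgroup.closure (Set.range fun i => sigma k n i ^ m)).toSubmonoid

/-- The action of `S_n` on `k(t_1, …, t_n)`, `π(t_i) = t_{π i}`. -/
def permRat : Equiv.Perm (Fin n) →* (RatField k n ≃ₐ[k] RatField k n) :=
  (ratExtend k n).comp
    { toFun := fun π => MvPolynomial.renameEquiv k π
      map_one' := AlgEquiv.coe_toAlgHom_injective
        (MvPolynomial.algHom_ext fun i => by simp)
      map_mul' := fun π τ => AlgEquiv.coe_toAlgHom_injective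
        (MvPolynomial.algHom_ext fun i => by simp) }

theorem permRat_ratVar (π : Equiv.Perm (Fin n)) (i : Fin n) :
    permRat k n π (ratVar k n i) = ratVar k n (π i) := by
  change ratExtend k n (MvPolynomial.renameEquiv k π) _ = _
  rw [ratExtend_ratVar]
  simp [ratVar]

theorem sigma_ratVar (i j : Fin n) :
    sigma k n i (ratVar k n j) = ratVar k n j - if i = j then 1 else 0 := by
  rw [sigma, shift_ratVar]
  by_cases h : i = j
  · subst h; simp
  · simp [h]

theorem sigma_inv_ratVar (i j : Fin n) :
    (sigma k n i)⁻¹ (ratVar k n j) = ratVar k n j + if i = j then 1 else 0 := by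
  rw [sigma, ← map_inv, shift_ratVar]
  by_cases h : i = j
  · subst h; simp
  · simp [h]

theorem sigma_comm (i j : Fin n) : sigma k n i * sigma k n j = sigma k n j * sigma k n i := by
  simp only [sigma, ← map_mul, mul_comm]

/-- The homomorphism `x_i ↦ σ_i`, `∂_i ↦ t_i σ_i⁻¹` from the Weyl algebra to the skew ring. -/
def weylEmbedding : WeylAlgebra k n →ₐ[k] SkewAut k (RatField k n) :=
  WeylAlgebra.lift (fun i => SkewMonoidAlgebra.single (sigma k n i) 1)
    (fun i => SkewMonoidAlgebra.single (sigma k n i)⁻¹ (ratVar k n i))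
    (fun i j => by simp [sigma_comm k n i j])
    (fun i j => by
      have h : (sigma k n i)⁻¹ * (sigma k n j)⁻¹ = (sigma k n j)⁻¹ * (sigma k n i)⁻¹ := by
        rw [← mul_inv_rev, ← mul_inv_rev, sigma_comm]
      simp only [SkewMonoidAlgebra.single_mul_single, AlgEquiv.smul_def, sigma_inv_ratVar, h]
      by_cases hij : i = j
      · subst hij; rfl
      · simp [hij, Ne.symm hij, mul_comm])
    (fun i j => by
      have h : (sigma k n i)⁻¹ * sigma k n j = sigma k n j * (sigma k n i)⁻¹ :=
        ((Commute.inv_left (sigma_comm k n i j)) : Commute _ _)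
      simp only [SkewMonoidAlgebra.single_mul_single, AlgEquiv.smul_def, sigma_ratVar, map_one, h,
        mul_one, one_mul]
      by_cases hij : i = j
      · subst hij
        simp [sub_eq_add_neg, ← SkewMonoidAlgebra.single_neg, ← SkewMonoidAlgebra.single_add]
      · simp [hij, Ne.symm hij])

end Weyl

end

/-! Inside the skew group ring the Weyl algebra is graded by `ℤ^n`: `x_i` and `∂_i` have degrees
`e_i` and `-e_i`, a homogeneous element of degree `a` is a polynomial times `σ^a`, and every degree
contains a nonzero element. The embedding is injective because the Weyl algebra is simple in
characteristic zero: the kernel, pulled back along normal ordering, is stable under partial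
derivatives, so if it were nonzero it would contain `1`.

The torus acts on degree `a` by a character, which is trivial on the `m`-th roots of unity exactly
when `m` divides every `a i`; permutations act through conjugation in the skew ring. So for all
three groups, with `H` the permutation part and `m = 1` in the alternating case, the image `U` of
the invariants is the intersection of the image of the Weyl algebra with `(L * M_m)^H`, and the
image of `Γ` is `k[t_1, …, t_n]^H` (`isInvariant_iff`, `isHarishChandra_and_isGaloisOrder`).

The remaining properties follow from this description. Artin's theorem gives the Galois extension `L
/ L^H`, and `L^H` is the fraction field of `Γ`. Symmetric polynomials clear the denominators of any
element of the skew ring without destroying invariance, so `K U = U K` is everything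
(`exists_symmetric_denominator`). A part of `U` over a finite support lies in a finite module over
`k[t_1, …, t_n]`, which is finite over the noetherian algebra of symmetric polynomials inside `Γ`;
this yields both the order condition and the Harish-Chandra condition (`leftFG_of_supportedOn`).
Finally, `U` is a finitely generated algebra by a Noether-type argument: left multiplication by the
`x_i` and right multiplication by the `∂_i` make the Weyl algebra a cyclic `k[X, Y]`-module, in
which `U` is stable under the symmetric functions of the `X_i^m` and of the `Y_i^m`
(`subalgebra_fg`). -/

noncomputable section

/-! ### Commutative algebra: polynomial operators, derivatives, finiteness over noetherian
subalgebras -/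

section CommEval

variable {k B σ : Type*} [CommRing k] [Ring B] [Algebra k B]

open scoped IsMulCommutative in
/-- Evaluation of polynomials at a commuting family of elements of a noncommutative algebra. -/
def commEval (f : σ → B) (hf : ∀ i j, f i * f j = f j * f i) : MvPolynomial σ k →ₐ[k] B :=
  haveI : IsMulCommutative (Algebra.adjoin k (Set.range f)) := Algebra.isMulCommutative_adjoin k (by
    rintro _ ⟨i, rfl⟩ _ ⟨j, rfl⟩; exact hf i j)
  (Algebra.adjoin k (Set.range f)).val.comp
    (MvPolynomial.aeval fun i => ⟨f i, Algebra.subset_adjoin ⟨i, rfl⟩⟩)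

open scoped IsMulCommutative in
@[simp]
theorem commEval_X (f : σ → B) (hf : ∀ i j, f i * f j = f j * f i) (i : σ) :
    commEval (k := k) f hf (MvPolynomial.X i) = f i := by
  have : IsMulCommutative (Algebra.adjoin k (Set.range f)) := Algebra.isMulCommutative_adjoin k (by
    rintro _ ⟨i, rfl⟩ _ ⟨j, rfl⟩; exact hf i j)
  change ((MvPolynomial.aeval (fun i => (⟨f i, Algebra.subset_adjoin ⟨i, rfl⟩⟩ :
    Algebra.adjoin k (Set.range f))) (MvPolynomial.X i : MvPolynomial σ k) :
    Algebra.adjoin k (Set.range f)) : B) = f i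
  rw [MvPolynomial.aeval_X]

end CommEval

open MvPolynomial in
/-- In characteristic zero a nonzero space of polynomials stable under the partial derivatives
contains the constants. -/
theorem one_mem_of_pderiv_mem {k σ : Type*} [Field k] [CharZero k]
    (I : Submodule k (MvPolynomial σ k)) (hI : ∀ i, ∀ f ∈ I, pderiv i f ∈ I)
    (f : MvPolynomial σ k) (hf : f ∈ I) (hf0 : f ≠ 0) : (1 : MvPolynomial σ k) ∈ I := by
  induction h : f.totalDegree using Nat.strong_induction_on generalizing f with
  | _ d ih =>
    subst h
    rcases Nat.eq_zero_or_pos f.totalDegree with h0 | hpos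
    · obtain ⟨c, rfl⟩ : ∃ c, f = C c := ⟨_, totalDegree_eq_zero_iff_eq_C.1 h0⟩
      have hc : c ≠ 0 := by rintro rfl; simp at hf0
      have := I.smul_mem c⁻¹ hf
      rwa [smul_eq_C_mul, ← C_mul, inv_mul_cancel₀ hc, C_1] at this
    · have hne : f.support.Nonempty := by simpa using hf0
      obtain ⟨s, hs, hsd⟩ := f.support.exists_mem_eq_sup hne fun s => s.sum fun _ e => e
      have hs0 : s ≠ 0 := by
        rintro rfl
        change f.totalDegree = _ at hsd
        simp at hsd
        omega
      obtain ⟨i, hi⟩ := Finsupp.ne_iff.1 hs0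
      have hsi : s i ≠ 0 := by simpa using hi
      have hle : Finsupp.single i 1 ≤ s := by
        rw [Finsupp.single_le_iff]; omega
      have hp0 : pderiv i f ≠ 0 := by
        intro h
        -- At `s - e_i` the derivative has coefficient `s i` times that of `f` at `s`, nonzero in
        -- characteristic zero.
        have h1 := congrArg (coeff (s - Finsupp.single i 1)) h
        rw [coeff_pderiv, tsub_add_cancel_of_le hle] at h1
        have : coeff s f ≠ 0 := mem_support_iff.1 hs
        rw [coeff_zero, mul_eq_zero] at h1
        rcases h1 with h1 | h1
        · exact this h1
        · norm_cast at h1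
      refine ih _ ?_ _ (hI i f hf) hp0 rfl
      -- Every monomial of the derivative comes from a monomial of `f` of degree one higher.
      rw [totalDegree, Finset.sup_lt_iff hpos]
      intro m hm
      have hm' : coeff (m + Finsupp.single i 1) f ≠ 0 := by
        intro h
        rw [mem_support_iff, coeff_pderiv, h, zero_mul] at hm
        exact hm rfl
      have := le_totalDegree (mem_support_iff.2 hm')
      rw [Finsupp.sum_add_index' (by simp) (by simp)] at this
      simp at this
      omega

/-- Let the commutative algebra `Q`, finite over its noetherian subalgebra `S`, act on `B`. An
`S`-stable subspace of a finitely generated `Q`-submodule of `B` is finitely generated over `S`. -/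
theorem exists_finset_span_of_stable {k Q B : Type*} [Field k] [CommRing Q] [Algebra k Q]
    [AddCommGroup B] [Module k B] (ρ : Q →ₐ[k] Module.End k B) (S : Subalgebra k Q)
    [IsNoetherianRing S] [Module.Finite S Q] (T : Finset B) (V : Submodule k B)
    (hV : V ≤ Submodule.span k {b | ∃ q : Q, ∃ t ∈ T, b = ρ q t})
    (hS : ∀ s ∈ S, ∀ v ∈ V, ρ s v ∈ V) :
    ∃ T' : Finset B, V = Submodule.span k {b | ∃ s ∈ S, ∃ t ∈ T', b = ρ s t} := by
  let _ : Module Q B := Module.compHom B (ρ : Q →+* Module.End k B)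
  have hsmul : ∀ (q : Q) (b : B), q • b = ρ q b := fun _ _ => rfl
  have hsmulS : ∀ (s : S) (b : B), s • b = ρ s b := fun _ _ => rfl
  have hk : ∀ (c : k) (b : B), c • b = (algebraMap k S c) • b := by
    intro c b
    rw [hsmulS]
    change _ = ρ (algebraMap k Q c) b
    rw [AlgHom.commutes]; rfl
  let N : Submodule Q B := Submodule.span Q (T : Set B)
  have : Module.Finite Q N := Module.Finite.iff_fg.2 ⟨T, rfl⟩
  have : IsScalarTower S Q N := ⟨fun a b c => by
    ext; change ((a : Q) * b) • (c : B) = (a : Q) • (b • (c : B)); rw [mul_smul]⟩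
  -- `N` is finitely generated over `Q`, hence over the noetherian ring `S`, so all its
  -- `S`-submodules are finitely generated.
  have : Module.Finite S N := Module.Finite.trans Q N
  let V' : Submodule S B :=
    { carrier := V
      add_mem' := V.add_mem
      zero_mem' := V.zero_mem
      smul_mem' := fun s v hv => hS s s.2 v hv }
  have hVN : V' ≤ N.restrictScalars S := by
    intro v hv
    have := hV hv
    clear hv
    induction this using Submodule.span_induction with
    | mem b hb =>
      obtain ⟨q, t, ht, rfl⟩ := hb
      exact N.smul_mem q (Submodule.subset_span ht)
    | zero => exact N.zero_mem
    | add a b _ _ ha hb => exact N.add_mem ha hb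
    | smul c b _ hb => rw [hk]; exact (N.restrictScalars S).smul_mem _ hb
  have hN : IsNoetherian S (N.restrictScalars S) := inferInstanceAs (IsNoetherian S N)
  obtain ⟨T', hT'⟩ := (isNoetherian_submodule.1 hN) V' hVN
  refine ⟨T', le_antisymm ?_ ?_⟩
  · intro v hv
    have hv' : v ∈ Submodule.span S (T' : Set B) := by rw [hT']; exact hv
    induction hv' using Submodule.span_induction with
    | mem b hb => exact Submodule.subset_span ⟨1, S.one_mem, b, hb, by simp⟩
    | zero => exact Submodule.zero_mem _
    | add a b ha' hb' ha hb =>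
      exact Submodule.add_mem _ (ha (by rw [hT'] at ha'; exact ha')) (hb (by rw [hT'] at hb'; exact hb'))
    | smul c b hb' hb =>
      have := hb (by rw [hT'] at hb'; exact hb')
      clear hv hb hb'
      induction this using Submodule.span_induction with
      | mem b hb =>
        obtain ⟨s, hs, t, ht, rfl⟩ := hb
        exact Submodule.subset_span ⟨c * s, S.mul_mem c.2 hs, t, ht, by rw [map_mul]; rfl⟩
      | zero => rw [smul_zero]; exact Submodule.zero_mem _
      | add a b _ _ ha hb => rw [smul_add]; exact Submodule.add_mem _ ha hb
      | smul d b _ hb =>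
        rw [hsmulS, map_smul]; exact Submodule.smul_mem _ _ hb
  · rw [Submodule.span_le]
    rintro _ ⟨s, hs, t, ht, rfl⟩
    have : t ∈ V' := hT' ▸ Submodule.subset_span ht
    exact hS s hs t this

open Polynomial in
/-- The entries of a family are integral over any ring containing its elementary symmetric
functions. -/
theorem isIntegral_of_esymm_mem {k Q σ : Type*} [Field k] [CommRing Q] [Algebra k Q] [Fintype σ]
    (S : Subalgebra k Q) (z : σ → Q)
    (h : ∀ j ≤ Fintype.card σ, MvPolynomial.aeval z (MvPolynomial.esymm σ k j) ∈ S) (i : σ) :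
    IsIntegral S (z i) := by
  rcases subsingleton_or_nontrivial Q with hQ | hQ
  · rw [Subsingleton.elim (z i) 0]; exact isIntegral_zero
  set s : Multiset Q := Finset.univ.val.map z with hs
  -- The coefficients of this monic polynomial are, up to sign, the elementary symmetric functions
  -- of its roots `z i`, so it lifts to `S[X]`.
  set p : Q[X] := (s.map fun t => X - C t).prod with hp
  have hmonic : p.Monic := monic_multiset_prod_of_monic _ _ fun t _ => monic_X_sub_C t
  have hdeg : p.natDegree = Multiset.card s := natDegree_multiset_prod_X_sub_C_eq_card s
  have hcoeff : p ∈ Polynomial.lifts (algebraMap S Q) := by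
    rw [Polynomial.lifts_iff_coeff_lifts]
    intro j
    rcases le_or_gt j (Multiset.card s) with hj | hj
    · rw [hp, Multiset.prod_X_sub_C_coeff s hj]
      have h1 : s.esymm (Multiset.card s - j) ∈ S := by
        have := h (Multiset.card s - j) (by simp [hs])
        rwa [MvPolynomial.aeval_esymm_eq_multiset_esymm] at this
      exact ⟨⟨_, S.mul_mem (S.pow_mem (S.neg_mem S.one_mem) _) h1⟩, rfl⟩
    · rw [coeff_eq_zero_of_natDegree_lt (hdeg ▸ hj)]
      exact ⟨0, map_zero _⟩
  obtain ⟨q, hq, -, hqm⟩ := Polynomial.lifts_and_natDegree_eq_and_monic hcoeff hmonic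
  refine ⟨q, hqm, ?_⟩
  rw [← eval_map, hq, hp, eval_multiset_prod]
  apply Multiset.prod_eq_zero
  simp only [Multiset.mem_map]
  exact ⟨X - C (z i), ⟨z i, by simp [hs], rfl⟩, by simp⟩

/-- Integrality need only be checked on the variables, and an integral algebra of finite type is
finite. -/
theorem finite_of_isIntegral_X {k σ : Type*} [Field k] [Finite σ]
    (S : Subalgebra k (MvPolynomial σ k)) (h : ∀ i, IsIntegral S (MvPolynomial.X i : MvPolynomial σ k)) :
    Module.Finite S (MvPolynomial σ k) := by
  have h1 : Algebra.IsIntegral S (MvPolynomial σ k) := ⟨fun p => by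
    induction p using MvPolynomial.induction_on with
    | C c => exact isIntegral_algebraMap (x := algebraMap k S c)
    | add p q hp hq => exact hp.add hq
    | mul_X p i hp => exact hp.mul (h i)⟩
  have h2 : Algebra.FiniteType S (MvPolynomial σ k) :=
    Algebra.FiniteType.of_restrictScalars_finiteType k S _
  exact Algebra.IsIntegral.finite

theorem isNoetherianRing_adjoin {k Q : Type*} [Field k] [CommRing Q] [Algebra k Q] {s : Set Q}
    (hs : s.Finite) : IsNoetherianRing (Algebra.adjoin k s) :=
  isNoetherianRing_of_fg (Subalgebra.fg_def.2 ⟨s, hs, rfl⟩)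


/-! ### Normal ordering and simplicity of the Weyl algebra -/

namespace WeylAlgebra

variable {k : Type*} [Field k] {n : ℕ}

/-- The universal property gives a homomorphism into `S` whose composite with the inclusion fixes
the generators, hence is the identity. -/
theorem eq_top_of_generators_mem (S : Subalgebra k (WeylAlgebra k n)) (hx : ∀ i, x k i ∈ S)
    (hd : ∀ i, d k i ∈ S) : S = ⊤ := by
  let f : WeylAlgebra k n →ₐ[k] S := lift (fun i => ⟨x k i, hx i⟩) (fun i => ⟨d k i, hd i⟩)
    (fun i j => Subtype.ext (x_mul_x k i j)) (fun i j => Subtype.ext (d_mul_d k i j))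
    (fun i j => Subtype.ext (by
      have := d_mul_x k i j
      split_ifs at this ⊢ <;> exact this))
  have hf : S.val.comp f = AlgHom.id k _ :=
    hom_ext (fun i => by simp [f, lift_x]) (fun i => by simp [f, lift_d])
  rw [eq_top_iff]
  intro u _
  have h : (f u : WeylAlgebra k n) = u := DFunLike.congr_fun hf u
  rw [← h]
  exact (f u).2

variable (k n) in
/-- The action of `k[X, Y]` on the Weyl algebra in which `X_i` is the left multiplication by `x_i`
and `Y_i` the right multiplication by `∂_i`. -/
def bimod : MvPolynomial (Fin n ⊕ Fin n) k →ₐ[k] Module.End k (WeylAlgebra k n) :=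
  commEval (Sum.elim (fun i => LinearMap.mulLeft k (x k i)) fun i => LinearMap.mulRight k (d k i))
    (by
      rintro (i | i) (j | j) <;> ext u
      · simp [← mul_assoc, x_mul_x k i j]
      · simp [← mul_assoc]
      · simp [← mul_assoc]
      · simp [mul_assoc, d_mul_d k i j])

theorem bimod_X_inl (i : Fin n) :
    bimod k n (MvPolynomial.X (Sum.inl i)) = LinearMap.mulLeft k (x k i) := commEval_X _ _ _

theorem bimod_X_inr (i : Fin n) :
    bimod k n (MvPolynomial.X (Sum.inr i)) = LinearMap.mulRight k (d k i) := commEval_X _ _ _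

theorem bimod_mul_X_inl (q : MvPolynomial (Fin n ⊕ Fin n) k) (i : Fin n) (u : WeylAlgebra k n) :
    bimod k n (q * MvPolynomial.X (Sum.inl i)) u = x k i * bimod k n q u := by
  rw [mul_comm, map_mul, bimod_X_inl]; rfl

theorem bimod_mul_X_inr (q : MvPolynomial (Fin n ⊕ Fin n) k) (i : Fin n) (u : WeylAlgebra k n) :
    bimod k n (q * MvPolynomial.X (Sum.inr i)) u = bimod k n q u * d k i := by
  rw [mul_comm, map_mul, bimod_X_inr]; rfl

theorem bimod_mul_X_inl_pow (q : MvPolynomial (Fin n ⊕ Fin n) k) (i : Fin n) (m : ℕ)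
    (u : WeylAlgebra k n) :
    bimod k n (q * MvPolynomial.X (Sum.inl i) ^ m) u = x k i ^ m * bimod k n q u := by
  rw [mul_comm, map_mul, map_pow, bimod_X_inl, LinearMap.pow_mulLeft]; rfl

theorem bimod_mul_X_inr_pow (q : MvPolynomial (Fin n ⊕ Fin n) k) (i : Fin n) (m : ℕ)
    (u : WeylAlgebra k n) :
    bimod k n (q * MvPolynomial.X (Sum.inr i) ^ m) u = bimod k n q u * d k i ^ m := by
  rw [mul_comm, map_mul, map_pow, bimod_X_inr, LinearMap.pow_mulRight]; rfl

theorem bimod_C (c : k) (u : WeylAlgebra k n) :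
    bimod k n (MvPolynomial.C c) u = c • u := by
  rw [← MvPolynomial.algebraMap_eq, AlgHom.commutes]; rfl

variable (k n) in
/-- The normally ordered element of the Weyl algebra given by a polynomial. -/
def normalOrder : MvPolynomial (Fin n ⊕ Fin n) k →ₗ[k] WeylAlgebra k n :=
  (LinearMap.applyₗ (1 : WeylAlgebra k n)).comp (bimod k n).toLinearMap

theorem normalOrder_apply (q : MvPolynomial (Fin n ⊕ Fin n) k) :
    normalOrder k n q = bimod k n q 1 := rfl

theorem normalOrder_mul_X_inl (q : MvPolynomial (Fin n ⊕ Fin n) k) (i : Fin n) :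
    normalOrder k n (q * MvPolynomial.X (Sum.inl i)) = x k i * normalOrder k n q :=
  bimod_mul_X_inl q i 1

theorem normalOrder_mul_X_inr (q : MvPolynomial (Fin n ⊕ Fin n) k) (i : Fin n) :
    normalOrder k n (q * MvPolynomial.X (Sum.inr i)) = normalOrder k n q * d k i :=
  bimod_mul_X_inr q i 1

theorem normalOrder_C (c : k) :
    normalOrder k n (MvPolynomial.C c) = algebraMap k _ c := by
  rw [normalOrder_apply, bimod_C, Algebra.algebraMap_eq_smul_one]

open MvPolynomial in
-- Moving `∂_i` to the right past the `x_j` differentiates in `X_i`, while the `∂_j` commute with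
-- it. So two-sided ideals pull back to spaces stable under this derivative.
theorem d_mul_normalOrder (q : MvPolynomial (Fin n ⊕ Fin n) k) (i : Fin n) :
    d k i * normalOrder k n q =
      normalOrder k n q * d k i + normalOrder k n (pderiv (Sum.inl i) q) := by
  induction q using MvPolynomial.induction_on with
  | C c => simp [normalOrder_C, Algebra.commutes]
  | add p q hp hq => rw [map_add, mul_add, add_mul, hp, hq, map_add, map_add]; abel
  | mul_X p j hp =>
    rw [Derivation.leibniz, smul_eq_mul, smul_eq_mul, map_add, mul_comm (X j)]
    rcases j with j | j
    · have h := d_mul_x k i j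
      rw [sub_eq_iff_eq_add] at h
      rw [normalOrder_mul_X_inl, normalOrder_mul_X_inl, ← mul_assoc, h, add_mul, mul_assoc, hp,
        mul_add, mul_assoc]
      by_cases hij : i = j
      · subst hij; simp; abel
      · simp [hij, pderiv_X]
    · rw [normalOrder_mul_X_inr, normalOrder_mul_X_inr, ← mul_assoc, hp, add_mul, mul_assoc,
        mul_assoc, d_mul_d k i j]
      simp [pderiv_X]

open MvPolynomial in
-- The mirror image: moving `x_i` to the left past the `∂_j` differentiates in `Y_i`.
theorem normalOrder_mul_x (q : MvPolynomial (Fin n ⊕ Fin n) k) (i : Fin n) :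
    normalOrder k n q * x k i =
      x k i * normalOrder k n q + normalOrder k n (pderiv (Sum.inr i) q) := by
  induction q using MvPolynomial.induction_on with
  | C c => simp [normalOrder_C, Algebra.commutes]
  | add p q hp hq => rw [map_add, mul_add, add_mul, hp, hq, map_add, map_add]; abel
  | mul_X p j hp =>
    rw [Derivation.leibniz, smul_eq_mul, smul_eq_mul, map_add, mul_comm (X j)]
    rcases j with j | j
    · rw [normalOrder_mul_X_inl, normalOrder_mul_X_inl, mul_assoc, hp, mul_add, ← mul_assoc,
        ← mul_assoc, x_mul_x k i j]
      simp [pderiv_X]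
    · have h := d_mul_x k j i
      rw [sub_eq_iff_eq_add] at h
      rw [normalOrder_mul_X_inr, normalOrder_mul_X_inr, mul_assoc, h, mul_add, ← mul_assoc, hp,
        add_mul, ← mul_assoc]
      by_cases hij : i = j
      · subst hij; simp; abel
      · simp [pderiv_X, Ne.symm hij]

/-- The image contains `1` and is a left ideal: it is stable under left multiplication by the `x_i`
and, by `d_mul_normalOrder`, by the `∂_i`. -/
theorem normalOrder_surjective : Function.Surjective (normalOrder k n) := by
  let S : Subalgebra k (WeylAlgebra k n) :=
    { carrier := {a | ∀ u ∈ LinearMap.range (normalOrder k n), a * u ∈ LinearMap.range (normalOrder k n)}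
      mul_mem' := fun {a b} ha hb u hu => by rw [mul_assoc]; exact ha _ (hb _ hu)
      add_mem' := fun {a b} ha hb u hu => by rw [add_mul]; exact add_mem (ha _ hu) (hb _ hu)
      algebraMap_mem' := fun r u hu => by
        rw [← Algebra.smul_def]; exact Submodule.smul_mem _ _ hu }
  have hS : S = ⊤ := eq_top_of_generators_mem S
    (by rintro i _ ⟨q, rfl⟩; exact ⟨_, normalOrder_mul_X_inl q i⟩)
    (by
      rintro i _ ⟨q, rfl⟩
      exact ⟨q * MvPolynomial.X (Sum.inr i) + MvPolynomial.pderiv (Sum.inl i) q, by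
        rw [map_add, normalOrder_mul_X_inr, d_mul_normalOrder]⟩)
  intro u
  have : u ∈ S := hS ▸ trivial
  simpa using this 1 ⟨1, by simpa using normalOrder_C (k := k) (n := n) 1⟩

/-- In characteristic zero the Weyl algebra is simple. -/
theorem injective_of_algHom [CharZero k] {B : Type*} [Ring B] [Algebra k B] [Nontrivial B]
    (f : WeylAlgebra k n →ₐ[k] B) : Function.Injective f := by
  rw [injective_iff_map_eq_zero]
  intro u hu
  obtain ⟨q, rfl⟩ := normalOrder_surjective u
  by_contra hne
  have hq : q ≠ 0 := by rintro rfl; simp at hne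
  -- In the image under `f` of a commutation identity the two product terms vanish, so the
  -- derivative term does too.
  have h1 := one_mem_of_pderiv_mem
    (LinearMap.ker (f.toLinearMap.comp (normalOrder k n))) (by
      rintro (i | i) p hp
      · have h := congrArg f (d_mul_normalOrder p i)
        have hp' : f (normalOrder k n p) = 0 := hp
        rw [map_mul, map_add, map_mul, hp'] at h
        simpa using h.symm
      · have h := congrArg f (normalOrder_mul_x p i)
        have hp' : f (normalOrder k n p) = 0 := hp
        rw [map_mul, map_add, map_mul, hp'] at h
        simpa using h.symm) q hu hq
  have h2 : f (normalOrder k n (MvPolynomial.C 1)) = 0 := h1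
  rw [normalOrder_C] at h2
  simp at h2

/-! ### Finite generation of algebras of invariants -/

/-- The elementary symmetric functions in `X_1^m, …, X_n^m`. -/
def esymmX (m j : ℕ) : MvPolynomial (Fin n ⊕ Fin n) k :=
  MvPolynomial.aeval (fun i => MvPolynomial.X (Sum.inl i) ^ m) (MvPolynomial.esymm (Fin n) k j)

/-- The elementary symmetric functions in `Y_1^m, …, Y_n^m`. -/
def esymmY (m j : ℕ) : MvPolynomial (Fin n ⊕ Fin n) k :=
  MvPolynomial.aeval (fun i => MvPolynomial.X (Sum.inr i) ^ m) (MvPolynomial.esymm (Fin n) k j)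

/-- Without `Y` variables only left factors occur, so the operator is multiplication by an element
of the Weyl algebra; a subalgebra containing that element is stable under it. -/
theorem bimod_powX (m : ℕ) (p : MvPolynomial (Fin n) k) (u : WeylAlgebra k n) :
    bimod k n (MvPolynomial.aeval (fun i => MvPolynomial.X (Sum.inl i) ^ m) p) u =
      normalOrder k n (MvPolynomial.aeval (fun i => MvPolynomial.X (Sum.inl i) ^ m) p) * u := by
  induction p using MvPolynomial.induction_on with
  | C c => simp [MvPolynomial.algebraMap_eq, normalOrder_C, Algebra.smul_def]
  | add p q hp hq => simp only [map_add, LinearMap.add_apply, hp, hq, add_mul]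
  | mul_X p i hp =>
    rw [map_mul, MvPolynomial.aeval_X, normalOrder_apply, bimod_mul_X_inl_pow, bimod_mul_X_inl_pow,
      hp, ← mul_assoc, normalOrder_apply]

theorem bimod_powY (m : ℕ) (p : MvPolynomial (Fin n) k) (u : WeylAlgebra k n) :
    bimod k n (MvPolynomial.aeval (fun i => MvPolynomial.X (Sum.inr i) ^ m) p) u =
      u * normalOrder k n (MvPolynomial.aeval (fun i => MvPolynomial.X (Sum.inr i) ^ m) p) := by
  induction p using MvPolynomial.induction_on with
  | C c => simp [MvPolynomial.algebraMap_eq, normalOrder_C, Algebra.smul_def, Algebra.commutes]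
  | add p q hp hq => simp only [map_add, LinearMap.add_apply, hp, hq, mul_add]
  | mul_X p i hp =>
    rw [map_mul, MvPolynomial.aeval_X, normalOrder_apply, bimod_mul_X_inr_pow, bimod_mul_X_inr_pow,
      hp, mul_assoc, normalOrder_apply]

/-- A subalgebra of the Weyl algebra that contains the symmetric functions of the `x_i^m` and of
the `∂_i^m` is finitely generated. -/
theorem subalgebra_fg (U : Subalgebra k (WeylAlgebra k n)) {m : ℕ} (hm : 1 ≤ m)
    (hX : ∀ j, normalOrder k n (esymmX m j) ∈ U) (hY : ∀ j, normalOrder k n (esymmY m j) ∈ U) :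
    U.FG := by
  classical
  let g : Finset (MvPolynomial (Fin n ⊕ Fin n) k) :=
    (Finset.range (n + 1)).image (esymmX m) ∪ (Finset.range (n + 1)).image (esymmY m)
  let S := Algebra.adjoin k (g : Set (MvPolynomial (Fin n ⊕ Fin n) k))
  have hSn : IsNoetherianRing S := isNoetherianRing_adjoin g.finite_toSet
  have hgX : ∀ j ≤ n, esymmX m j ∈ S := fun j hj => Algebra.subset_adjoin <| by
    simp only [g, Finset.coe_union, Finset.coe_image]
    exact Or.inl ⟨j, by simp; omega, rfl⟩
  have hgY : ∀ j ≤ n, esymmY m j ∈ S := fun j hj => Algebra.subset_adjoin <| by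
    simp only [g, Finset.coe_union, Finset.coe_image]
    exact Or.inr ⟨j, by simp; omega, rfl⟩
  -- The `m`-th powers of the variables are integral over `S`, hence so are the variables, as `m ≥
  -- 1`.
  have hSf : Module.Finite S (MvPolynomial (Fin n ⊕ Fin n) k) := finite_of_isIntegral_X S (by
    rintro (i | i)
    · exact IsIntegral.of_pow hm (isIntegral_of_esymm_mem S
        (fun i => MvPolynomial.X (Sum.inl i) ^ m) (fun j hj => hgX j (by simpa using hj)) i)
    · exact IsIntegral.of_pow hm (isIntegral_of_esymm_mem S
        (fun i => MvPolynomial.X (Sum.inr i) ^ m) (fun j hj => hgY j (by simpa using hj)) i))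
  -- `B` is arbitrary because this is applied both to `U` and to the algebra generated by `G`.
  have hstable : ∀ B : Subalgebra k (WeylAlgebra k n), (∀ j ≤ n, normalOrder k n (esymmX m j) ∈ B) →
      (∀ j ≤ n, normalOrder k n (esymmY m j) ∈ B) → ∀ s ∈ S, ∀ u ∈ B, bimod k n s u ∈ B := by
    intro B hBX hBY s hs
    induction hs using Algebra.adjoin_induction with
    | mem s hs =>
      intro u hu
      simp only [g, Finset.coe_union, Finset.coe_image] at hs
      rcases hs with ⟨j, hj, rfl⟩ | ⟨j, hj, rfl⟩
      · rw [esymmX, bimod_powX]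
        exact B.mul_mem (hBX j (by simp at hj; omega)) hu
      · rw [esymmY, bimod_powY]
        exact B.mul_mem hu (hBY j (by simp at hj; omega))
    | algebraMap r =>
      intro u hu
      rw [MvPolynomial.algebraMap_eq, bimod_C]
      exact B.smul_mem hu r
    | add a b _ _ ha hb =>
      intro u hu
      rw [map_add]
      exact B.add_mem (ha u hu) (hb u hu)
    | mul a b _ _ ha hb =>
      intro u hu
      rw [map_mul]
      exact ha _ (hb u hu)
  -- The single generator `1` suffices, since normal ordering is surjective.
  obtain ⟨T, hT⟩ := exists_finset_span_of_stable (bimod k n) S {1} (Subalgebra.toSubmodule U)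
    (fun u _ => by
      obtain ⟨q, rfl⟩ := normalOrder_surjective u
      exact Submodule.subset_span ⟨q, 1, by simp, rfl⟩)
    (hstable U (fun j _ => hX j) fun j _ => hY j)
  let G : Finset (WeylAlgebra k n) := T ∪ ((Finset.range (n + 1)).image
    (fun j => normalOrder k n (esymmX m j)) ∪ (Finset.range (n + 1)).image
    (fun j => normalOrder k n (esymmY m j)))
  have hTU : ∀ t ∈ T, t ∈ U := fun t ht => by
    have : t ∈ Subalgebra.toSubmodule U := by
      rw [hT]; exact Submodule.subset_span ⟨1, S.one_mem, t, ht, by simp⟩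
    exact this
  refine ⟨G, le_antisymm ?_ ?_⟩
  · rw [Algebra.adjoin_le_iff]
    intro u hu
    simp only [G, Finset.coe_union, Finset.coe_image] at hu
    rcases hu with h | ⟨j, -, rfl⟩ | ⟨j, -, rfl⟩
    · exact hTU u h
    · exact hX j
    · exact hY j
  · intro u hu
    have hu' : u ∈ Subalgebra.toSubmodule U := hu
    rw [hT] at hu'
    refine (Submodule.span_le (p := Subalgebra.toSubmodule (Algebra.adjoin k (G : Set (WeylAlgebra k n))))).2 ?_ hu'
    rintro _ ⟨s, hs, t, ht, rfl⟩
    refine hstable _ (fun j hj => Algebra.subset_adjoin ?_) (fun j hj => Algebra.subset_adjoin ?_)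
      s hs t (Algebra.subset_adjoin ?_)
    · simp only [G, Finset.coe_union, Finset.coe_image]
      exact Or.inr (Or.inl ⟨j, by simp; omega, rfl⟩)
    · simp only [G, Finset.coe_union, Finset.coe_image]
      exact Or.inr (Or.inr ⟨j, by simp; omega, rfl⟩)
    · simp only [G, Finset.coe_union, Finset.coe_image]
      exact Or.inl ht

end WeylAlgebra


/-! ### The rational function field, shifts and permutations -/

section RatField

variable (k : Type*) [Field k] (n : ℕ)

/-- The subalgebra `k[t_1, …, t_n]` of `k(t_1, …, t_n)`. -/
def polyRange : Subalgebra k (RatField k n) :=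
  (IsScalarTower.toAlgHom k (MvPolynomial (Fin n) k) (RatField k n)).range

variable {k n}

theorem algebraMap_mem_polyRange (p : MvPolynomial (Fin n) k) :
    algebraMap _ (RatField k n) p ∈ polyRange k n := ⟨p, rfl⟩

theorem mem_polyRange {l : RatField k n} :
    l ∈ polyRange k n ↔ ∃ p : MvPolynomial (Fin n) k, algebraMap _ (RatField k n) p = l := Iff.rfl

variable (k n) in
theorem polyRange_eq_adjoin : polyRange k n = Algebra.adjoin k (Set.range (ratVar k n)) := by
  rw [polyRange, ← Algebra.map_top, ← MvPolynomial.adjoin_range_X, AlgHom.map_adjoin,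
    ← Set.range_comp]
  rfl

theorem ratExtend_algebraMap (f : MvPolynomial (Fin n) k ≃ₐ[k] MvPolynomial (Fin n) k)
    (p : MvPolynomial (Fin n) k) :
    ratExtend k n f (algebraMap _ _ p) = algebraMap _ _ (f p) := by
  simp [ratExtend]

theorem ratExtend_mem_polyRange (f : MvPolynomial (Fin n) k ≃ₐ[k] MvPolynomial (Fin n) k)
    {l : RatField k n} (hl : l ∈ polyRange k n) : ratExtend k n f l ∈ polyRange k n := by
  obtain ⟨p, rfl⟩ := mem_polyRange.1 hl
  rw [ratExtend_algebraMap]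
  exact algebraMap_mem_polyRange _

theorem shift_mem_polyRange (a : Multiplicative (Fin n → ℤ)) {l : RatField k n}
    (hl : l ∈ polyRange k n) : shift k n a l ∈ polyRange k n := ratExtend_mem_polyRange _ hl

theorem permRat_mem_polyRange (π : Equiv.Perm (Fin n)) {l : RatField k n}
    (hl : l ∈ polyRange k n) : permRat k n π l ∈ polyRange k n := ratExtend_mem_polyRange _ hl

theorem ratVar_mem_polyRange (i : Fin n) : ratVar k n i ∈ polyRange k n :=
  algebraMap_mem_polyRange _

theorem ratVar_ne_zero (i : Fin n) : ratVar k n i ≠ 0 := by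
  rw [ratVar, Ne, map_eq_zero_iff _ (IsFractionRing.injective _ _)]
  exact MvPolynomial.X_ne_zero i

theorem ratAut_ext {f g : RatField k n ≃ₐ[k] RatField k n}
    (h : ∀ i, f (ratVar k n i) = g (ratVar k n i)) : f = g := by
  have h1 : ∀ p : MvPolynomial (Fin n) k, f (algebraMap _ _ p) = g (algebraMap _ _ p) := by
    intro p
    have := MvPolynomial.algHom_ext
      (f := (f : RatField k n →ₐ[k] RatField k n).comp
        (IsScalarTower.toAlgHom k (MvPolynomial (Fin n) k) (RatField k n)))
      (g := (g : RatField k n →ₐ[k] RatField k n).comp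
        (IsScalarTower.toAlgHom k (MvPolynomial (Fin n) k) (RatField k n))) h
    exact DFunLike.congr_fun this p
  ext l
  obtain ⟨p, q, -, rfl⟩ := IsFractionRing.div_surjective (A := MvPolynomial (Fin n) k) l
  rw [map_div₀, map_div₀, h1, h1]

/-- Conjugation only permutes the entries of the shift vector, so permutations normalize every
lattice `m ℤ^n` of shifts. -/
theorem permRat_conj_shift (π : Equiv.Perm (Fin n)) (a : Fin n → ℤ) :
    permRat k n π * shift k n (Multiplicative.ofAdd a) * (permRat k n π)⁻¹ =
      shift k n (Multiplicative.ofAdd fun i => a (π⁻¹ i)) := by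
  apply ratAut_ext
  intro i
  rw [← map_inv, AlgEquiv.mul_apply, AlgEquiv.mul_apply, permRat_ratVar, shift_ratVar, map_sub,
    permRat_ratVar, shift_ratVar, AlgEquiv.commutes]
  simp

theorem permRat_conj_sigma (π : Equiv.Perm (Fin n)) (i : Fin n) :
    permRat k n π * sigma k n i * (permRat k n π)⁻¹ = sigma k n (π i) := by
  rw [sigma, permRat_conj_shift, sigma]
  congr 2
  ext j
  simp [Pi.single_apply, Equiv.symm_apply_eq]

/-- Turns membership into divisibility of the shift vector by `m`. -/
theorem mem_shiftMonoid {m : ℕ} {g : RatField k n ≃ₐ[k] RatField k n} :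
    g ∈ shiftMonoid k n m ↔ ∃ a : Fin n → ℤ, g = shift k n (Multiplicative.ofAdd ((m : ℤ) • a)) := by
  have hs : ∀ i, sigma k n i ^ m =
      shift k n (Multiplicative.ofAdd ((m : ℤ) • (Pi.single i 1 : Fin n → ℤ))) := by
    intro i
    rw [sigma, ← map_pow, ← ofAdd_nsmul, natCast_zsmul]
  constructor
  · intro hg
    have hg' : g ∈ Subgroup.closure (Set.range fun i => sigma k n i ^ m) := hg
    clear hg
    induction hg' using Subgroup.closure_induction with
    | mem g hg => obtain ⟨i, rfl⟩ := hg; exact ⟨_, hs i⟩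
    | one => exact ⟨0, by simp⟩
    | mul g h _ _ hg hh =>
      obtain ⟨a, rfl⟩ := hg
      obtain ⟨b, rfl⟩ := hh
      exact ⟨a + b, by rw [smul_add, ofAdd_add, map_mul]⟩
    | inv g hg' hg =>
      obtain ⟨a, rfl⟩ := hg
      exact ⟨-a, by rw [smul_neg, ofAdd_neg, map_inv]⟩
  · rintro ⟨a, rfl⟩
    change _ ∈ Subgroup.closure (Set.range fun i => sigma k n i ^ m)
    rw [← Subgroup.mem_comap]
    have h : Multiplicative.ofAdd ((m : ℤ) • a) =
        ∏ i, Multiplicative.ofAdd ((m : ℤ) • (Pi.single i 1 : Fin n → ℤ)) ^ a i := by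
      apply Multiplicative.toAdd.injective
      rw [toAdd_prod]
      simp only [toAdd_zpow, toAdd_ofAdd]
      ext j
      simp [Finset.sum_apply, Pi.single_apply, mul_comm]
    rw [h]
    refine Subgroup.prod_mem _ fun i _ => Subgroup.zpow_mem _ ?_ _
    rw [Subgroup.mem_comap, ← hs]
    exact Subgroup.subset_closure ⟨i, rfl⟩

end RatField

/-! ### The grading of the embedded Weyl algebra and its invariants -/

section Embedding

variable {k : Type*} [Field k] {n : ℕ}

open WeylAlgebra SkewMonoidAlgebra

theorem weylEmbedding_x (i : Fin n) :
    weylEmbedding k n (x k i) = single (sigma k n i) 1 := lift_x _ _ _ _ _ i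

theorem weylEmbedding_d (i : Fin n) :
    weylEmbedding k n (d k i) = single (sigma k n i)⁻¹ (ratVar k n i) := lift_d _ _ _ _ _ i

theorem skewCoeff_apply {L : Type*} [Field L] [Algebra k L] (l : L) :
    skewCoeff k L l = single 1 l := rfl

theorem weylEmbedding_t (i : Fin n) :
    weylEmbedding k n (t k i) = skewCoeff k _ (ratVar k n i) := by
  rw [t, map_mul, weylEmbedding_x, weylEmbedding_d, single_mul_single, skewCoeff_apply]
  simp

theorem map_adjoin_t : (Algebra.adjoin k (Set.range (t k))).map (weylEmbedding k n) =
    (polyRange k n).map (skewCoeff k (RatField k n)) := by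
  rw [polyRange_eq_adjoin, AlgHom.map_adjoin, AlgHom.map_adjoin, ← Set.range_comp, ← Set.range_comp]
  congr 2
  ext i : 1
  exact weylEmbedding_t i

/-- The image of the Weyl algebra meets each line `L σ^a` in a nonzero multiple of
`k[t_1, …, t_n] σ^a`. -/
theorem exists_weylEmbedding_eq_single (a : Fin n → ℤ) :
    ∃ (u : WeylAlgebra k n) (c : RatField k n), c ∈ polyRange k n ∧ c ≠ 0 ∧
      weylEmbedding k n u = single (shift k n (Multiplicative.ofAdd a)) c := by
  -- The degrees for which the claim holds form a submonoid, so the vectors `±e_i`, realized by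
  -- `x_i` and `∂_i`, suffice.
  let M : AddSubmonoid (Fin n → ℤ) :=
    { carrier := {a | ∃ (u : WeylAlgebra k n) (c : RatField k n), c ∈ polyRange k n ∧ c ≠ 0 ∧
        weylEmbedding k n u = single (shift k n (Multiplicative.ofAdd a)) c}
      zero_mem' := ⟨1, 1, one_mem _, one_ne_zero, by simp⟩
      add_mem' := by
        rintro a b ⟨u, c, hc, hc0, hu⟩ ⟨v, e, he, he0, hv⟩
        refine ⟨u * v, c * shift k n (Multiplicative.ofAdd a) e,
          mul_mem hc (shift_mem_polyRange _ he), mul_ne_zero hc0 (by simpa using he0), ?_⟩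
        rw [map_mul, hu, hv, single_mul_single, ofAdd_add, map_mul, AlgEquiv.smul_def] }
  have h1 : ∀ i, Pi.single i 1 ∈ M := fun i =>
    ⟨x k i, 1, one_mem _, one_ne_zero, weylEmbedding_x i⟩
  have h2 : ∀ i, Pi.single i (-1) ∈ M := fun i =>
    ⟨d k i, ratVar k n i, ratVar_mem_polyRange i, ratVar_ne_zero i, by
      rw [weylEmbedding_d, Pi.single_neg, ofAdd_neg, map_inv, sigma]⟩
  have h3 : ∀ i z, Pi.single i z ∈ M := by
    intro i z
    rcases le_total 0 z with hz | hz
    · have := M.nsmul_mem (h1 i) z.natAbs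
      rw [← Pi.single_smul] at this
      simpa [abs_of_nonneg hz] using this
    · have := M.nsmul_mem (h2 i) z.natAbs
      rw [← Pi.single_smul] at this
      simpa [abs_of_nonpos hz] using this
  have : a ∈ M := by
    rw [← Finset.univ_sum_single a]
    exact M.sum_mem fun i _ => h3 i _
  exact this

/-- Induction on the decomposition of an element of the Weyl algebra into its components with
respect to the grading by `ℤ^n`. -/
theorem WeylAlgebra.graded_induction {P : WeylAlgebra k n → Prop}
    (h : ∀ u a l, weylEmbedding k n u = single (shift k n (Multiplicative.ofAdd a)) l →
      l ∈ polyRange k n →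
      (∀ ζ : Fin n → kˣ, torusHom ζ u = ((∏ i, (ζ i) ^ (-a i) : kˣ) : k) • u) → P u)
    (hadd : ∀ u v, P u → P v → P (u + v)) (u : WeylAlgebra k n) : P u := by
  obtain ⟨q, rfl⟩ := normalOrder_surjective u
  induction q using MvPolynomial.induction_on' with
  | add p q hp hq => rw [map_add]; exact hadd _ _ hp hq
  | monomial s c =>
    obtain ⟨a, l, h1, h2, h3⟩ : ∃ a l, weylEmbedding k n (normalOrder k n (MvPolynomial.monomial s c))
        = single (shift k n (Multiplicative.ofAdd a)) l ∧ l ∈ polyRange k n ∧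
        (∀ ζ : Fin n → kˣ, torusHom ζ (normalOrder k n (MvPolynomial.monomial s c)) =
          ((∏ i, (ζ i) ^ (-a i) : kˣ) : k) • normalOrder k n (MvPolynomial.monomial s c)) := by
      -- A factor `X_j` adds `e_j` to the degree and a factor `Y_j` subtracts it; the torus weight
      -- is multiplied accordingly.
      refine MvPolynomial.induction_on_monomial (motive := fun p => ∃ a l,
        weylEmbedding k n (normalOrder k n p) = single (shift k n (Multiplicative.ofAdd a)) l ∧
        l ∈ polyRange k n ∧ (∀ ζ : Fin n → kˣ, torusHom ζ (normalOrder k n p) =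
          ((∏ i, (ζ i) ^ (-a i) : kˣ) : k) • normalOrder k n p)) ?_ ?_ s c
      · intro c
        refine ⟨0, algebraMap k _ c, ?_, Subalgebra.algebraMap_mem _ _, fun ζ => ?_⟩
        · rw [normalOrder_C, AlgHom.commutes, ofAdd_zero, map_one]
          rfl
        · rw [normalOrder_C, AlgHom.commutes]; simp
      · rintro p j ⟨a, l, h1, h2, h3⟩
        rcases j with j | j
        · refine ⟨Pi.single j 1 + a, sigma k n j l, ?_, shift_mem_polyRange _ h2, fun ζ => ?_⟩
          · rw [normalOrder_mul_X_inl, map_mul, h1, weylEmbedding_x, single_mul_single, ofAdd_add,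
              map_mul, one_mul, AlgEquiv.smul_def, sigma]
          · have e : ∏ i, (ζ i) ^ (-(Pi.single j 1 + a : Fin n → ℤ) i) = (ζ j)⁻¹ * ∏ i, (ζ i) ^ (-a i) := by
              simp only [Pi.add_apply, neg_add, zpow_add, Finset.prod_mul_distrib]
              congr 1
              rw [Finset.prod_eq_single j (fun i _ hi => by simp [hi]) (by simp)]
              simp
            rw [normalOrder_mul_X_inl, map_mul, h3, torusHom_x, e, Units.val_mul,
              smul_mul_smul_comm]
        · refine ⟨a + Pi.single j (-1), l * shift k n (Multiplicative.ofAdd a) (ratVar k n j), ?_,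
            mul_mem h2 (shift_mem_polyRange _ (ratVar_mem_polyRange j)), fun ζ => ?_⟩
          · rw [normalOrder_mul_X_inr, map_mul, h1, weylEmbedding_d, single_mul_single, ofAdd_add,
              map_mul, AlgEquiv.smul_def, Pi.single_neg, ofAdd_neg, map_inv, sigma]
          · have e : ∏ i, (ζ i) ^ (-(a + Pi.single j (-1) : Fin n → ℤ) i) = (∏ i, (ζ i) ^ (-a i)) * ζ j := by
              simp only [Pi.add_apply, neg_add, zpow_add, Finset.prod_mul_distrib]
              congr 1
              rw [Finset.prod_eq_single j (fun i _ hi => by simp [hi]) (by simp)]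
              simp
            rw [normalOrder_mul_X_inr, map_mul, h3, torusHom_d, e, Units.val_mul,
              smul_mul_smul_comm]
    exact h _ a l h1 h2 h3

/-- The integrality behind the order condition: it holds for homogeneous elements and passes to
sums. -/
theorem coeff_weylEmbedding_mem (u : WeylAlgebra k n) (g : RatField k n ≃ₐ[k] RatField k n) :
    (weylEmbedding k n u).coeff g ∈ polyRange k n := by
  induction u using WeylAlgebra.graded_induction with
  | h u a l h1 h2 _ =>
    classical
    rw [h1, coeff_single_apply]
    split_ifs
    · exact h2
    · exact zero_mem _
  | hadd u v hu hv => rw [map_add, coeff_add]; exact add_mem hu hv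

theorem weylEmbedding_mem_skewMonoidRing (u : WeylAlgebra k n) :
    weylEmbedding k n u ∈ skewMonoidRing (shiftMonoid k n 1) := by
  induction u using WeylAlgebra.graded_induction with
  | h u a l h1 _ _ =>
    rw [h1]
    intro g hg
    rw [Finset.mem_singleton.1 (support_single_subset hg), mem_shiftMonoid]
    exact ⟨a, by simp⟩
  | hadd u v hu hv => rw [map_add]; exact add_mem hu hv

theorem exists_eq_shift {u : WeylAlgebra k n} {g : RatField k n ≃ₐ[k] RatField k n}
    (hg : g ∈ (weylEmbedding k n u).support) :
    ∃ a, g = shift k n (Multiplicative.ofAdd a) := by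
  obtain ⟨a, ha⟩ := mem_shiftMonoid.1 (weylEmbedding_mem_skewMonoidRing u g hg)
  exact ⟨a, by simpa using ha⟩

/-- The torus acts on each degree by a character. Characteristic zero ensures that a shift
determines its degree. -/
theorem coeff_weylEmbedding_torusHom [CharZero k] (ζ : Fin n → kˣ) (u : WeylAlgebra k n)
    (a : Fin n → ℤ) :
    (weylEmbedding k n (torusHom ζ u)).coeff (shift k n (Multiplicative.ofAdd a)) =
      ((∏ i, (ζ i) ^ (-a i) : kˣ) : k) •
        (weylEmbedding k n u).coeff (shift k n (Multiplicative.ofAdd a)) := by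
  induction u using WeylAlgebra.graded_induction with
  | h u b l h1 _ h3 =>
    classical
    rw [h3, map_smul, coeff_smul, Finsupp.smul_apply, h1, coeff_single_apply]
    split_ifs with hab
    · rw [Multiplicative.ofAdd.injective (shift_injective k n hab)]
    · simp
  | hadd u v hu hv => rw [map_add, map_add, coeff_add, Finsupp.add_apply, hu, hv, map_add, coeff_add,
      Finsupp.add_apply, smul_add]

theorem weylEmbedding_injective [CharZero k] : Function.Injective (weylEmbedding k n) :=
  injective_of_algHom _

/-- The invariants of the `m`-th roots of unity are the elements supported on `m ℤ^n`. -/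
theorem cyclicAct_eq_self_iff [IsAlgClosed k] [CharZero k] {m : ℕ} (hm : 1 ≤ m)
    (u : WeylAlgebra k n) :
    (∀ ζ, cyclicAct k n m ζ u = u) ↔
      weylEmbedding k n u ∈ skewMonoidRing (shiftMonoid k n m) := by
  classical
  have hact : ∀ ζ : CyclicProduct k n m, cyclicAct k n m ζ u = torusHom (fun i => (ζ i : kˣ)) u :=
    fun _ => rfl
  constructor
  · intro h g hg
    obtain ⟨a, rfl⟩ := exists_eq_shift hg
    have hdvd : ∀ i, (m : ℤ) ∣ a i := by
      intro i
      have : NeZero m := ⟨by omega⟩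
      have : NeZero (m : k) := ⟨by exact_mod_cast (by omega : m ≠ 0)⟩
      -- A primitive root `z` in the `i`-th factor multiplies the nonzero coefficient by `z ^ (-a
      -- i)`, so invariance forces `m ∣ a i`.
      obtain ⟨z, hz⟩ := HasEnoughRootsOfUnity.exists_primitiveRoot k m
      obtain ⟨z, rfl⟩ := hz.isUnit (by omega)
      have hz' : IsPrimitiveRoot z m := IsPrimitiveRoot.coe_units_iff.1 hz
      have hzm : z ∈ rootsOfUnity m k := hz'.pow_eq_one
      have h1 := coeff_weylEmbedding_torusHom
        (fun j => ((Pi.mulSingle i ⟨z, hzm⟩ : CyclicProduct k n m) j : kˣ)) u a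
      rw [← hact, h, Finset.prod_eq_single i (fun j _ hj => by simp [hj]) (by simp)] at h1
      have h2 : ((z ^ (-a i) : kˣ) : k) = 1 := by
        have h0 := mem_support_iff.1 hg
        rw [Algebra.smul_def] at h1
        have := mul_right_cancel₀ h0 ((one_mul _).trans h1)
        apply (algebraMap k (RatField k n)).injective
        rw [map_one, this]
        simp
      rw [← hz'.zpow_eq_one_iff_dvd]
      have h3 : z ^ (-a i) = 1 := Units.ext h2
      rwa [zpow_neg, inv_eq_one] at h3
    choose b hb using hdvd
    rw [mem_shiftMonoid]
    exact ⟨b, by congr 2; ext i; simp [hb]⟩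
  · intro h ζ
    apply weylEmbedding_injective
    rw [hact]
    ext g
    by_cases hg : ∃ a, g = shift k n (Multiplicative.ofAdd a)
    · obtain ⟨a, rfl⟩ := hg
      rw [coeff_weylEmbedding_torusHom]
      by_cases ha : shift k n (Multiplicative.ofAdd a) ∈ (weylEmbedding k n u).support
      · obtain ⟨b, hb⟩ := mem_shiftMonoid.1 (h _ ha)
        have hb := Multiplicative.ofAdd.injective (shift_injective k n hb)
        have : ∏ i, (ζ i : kˣ) ^ (-a i) = 1 := Finset.prod_eq_one fun i _ => by
          have hz : (ζ i : kˣ) ^ m = 1 := (ζ i).2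
          rw [hb, Pi.smul_apply, smul_eq_mul, zpow_neg, zpow_mul, zpow_natCast, hz, one_zpow,
            inv_one]
        rw [this]; simp
      · rw [notMem_support_iff] at ha
        rw [ha, smul_zero]
    · have h1 : ∀ v : WeylAlgebra k n, (weylEmbedding k n v).coeff g = 0 := by
        intro v
        by_contra hne
        exact hg (exists_eq_shift (mem_support_iff.2 hne))
      rw [h1, h1]

theorem weylEmbedding_permHom (π : Equiv.Perm (Fin n)) (u : WeylAlgebra k n) :
    weylEmbedding k n (permHom π u) = skewConj (permRat k n π) (weylEmbedding k n u) := by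
  have : (weylEmbedding k n).comp (permHom π) =
      (skewConj (permRat k n π)).comp (weylEmbedding k n) := by
    apply hom_ext
    · intro i
      simp only [AlgHom.comp_apply]
      rw [permHom_x, weylEmbedding_x, weylEmbedding_x, skewConj_single, permRat_conj_sigma, map_one]
    · intro i
      have h : permRat k n π * (sigma k n i)⁻¹ * (permRat k n π)⁻¹ = (sigma k n (π i))⁻¹ := by
        rw [← permRat_conj_sigma]; group
      simp only [AlgHom.comp_apply]
      rw [permHom_d, weylEmbedding_d, weylEmbedding_d, skewConj_single, h, permRat_ratVar]
  exact DFunLike.congr_fun this u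

theorem mem_invSkewMonoidRing {L : Type*} [Field L] [Algebra k L] {M : Submonoid (L ≃ₐ[k] L)}
    {G : Subgroup (L ≃ₐ[k] L)} {y : SkewAut k L} :
    y ∈ invSkewMonoidRing M G ↔ y ∈ skewMonoidRing M ∧ ∀ g ∈ G, skewConj g y = y := by
  simp [invSkewMonoidRing, Algebra.mem_inf, Algebra.mem_iInf, AlgHom.mem_equalizer]

/-- Invariance under `G_m^{⊗ n} ⋊ H`, for a group `H` of permutations, in terms of the skew group
ring. -/
theorem isInvariant_iff [IsAlgClosed k] [CharZero k] {m : ℕ} (hm : 1 ≤ m)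
    (H : Subgroup (Equiv.Perm (Fin n))) (u : WeylAlgebra k n) :
    ((∀ ζ, cyclicAct k n m ζ u = u) ∧ ∀ π ∈ H, permHom π u = u) ↔
      weylEmbedding k n u ∈ invSkewMonoidRing (shiftMonoid k n m) (H.map (permRat k n)) := by
  rw [mem_invSkewMonoidRing, cyclicAct_eq_self_iff hm]
  refine and_congr_right fun _ => ?_
  constructor
  · rintro h _ ⟨π, hπ, rfl⟩
    rw [← weylEmbedding_permHom, h π hπ]
  · intro h π hπ
    apply weylEmbedding_injective
    rw [weylEmbedding_permHom, h _ ⟨π, hπ, rfl⟩]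

end Embedding

/-! ### One-sided finite generation -/

section FiniteGeneration

variable {k Q B : Type*} [Field k] [CommRing Q] [Algebra k Q] [Ring B] [Algebra k B]

/-- The action of a commutative algebra by right multiplication. -/
def rightMul (ι : Q →ₐ[k] B) : Q →ₐ[k] Module.End k B where
  toFun q := LinearMap.mulRight k (ι q)
  map_one' := by ext; simp
  map_mul' p q := by ext b; simp [mul_comm p q, mul_assoc]
  map_zero' := by ext; simp
  map_add' p q := by ext b; simp [mul_add]
  commutes' r := by ext b; simp [Algebra.smul_def, Algebra.commutes]

/-- `Γ` need not be known to be noetherian: generators over the smaller algebra `ι S` still generate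
over `Γ`, because `V` is stable under `Γ`. -/
theorem leftFG_of_stable (ι : Q →ₐ[k] B) (S : Subalgebra k Q) [IsNoetherianRing S]
    [Module.Finite S Q] (Γ : Subalgebra k B) (hS : ∀ s ∈ S, ι s ∈ Γ) (T : Finset B)
    (V : Submodule k B) (hV : V ≤ Submodule.span k {b | ∃ q, ∃ t ∈ T, b = ι q * t})
    (hΓ : ∀ γ ∈ Γ, ∀ v ∈ V, γ * v ∈ V) : LeftFG Γ V := by
  obtain ⟨T', hT'⟩ := exists_finset_span_of_stable ((Algebra.lmul k B).comp ι) S T V hV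
    (fun s hs v hv => hΓ _ (hS s hs) v hv)
  refine ⟨T', le_antisymm ?_ ?_⟩
  · conv_lhs => rw [hT']
    rw [Submodule.span_le]
    rintro _ ⟨s, hs, t, ht, rfl⟩
    exact Submodule.mul_mem_mul (hS s hs) (Submodule.subset_span ht)
  · rw [Submodule.mul_le]
    intro γ hγ v hv
    refine hΓ γ hγ v ((Submodule.span_le (p := V)).2 ?_ hv)
    intro t ht
    rw [hT']
    exact Submodule.subset_span ⟨1, S.one_mem, t, ht, by simp⟩

theorem rightFG_of_stable (ι : Q →ₐ[k] B) (S : Subalgebra k Q) [IsNoetherianRing S]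
    [Module.Finite S Q] (Γ : Subalgebra k B) (hS : ∀ s ∈ S, ι s ∈ Γ) (T : Finset B)
    (V : Submodule k B) (hV : V ≤ Submodule.span k {b | ∃ q, ∃ t ∈ T, b = t * ι q})
    (hΓ : ∀ γ ∈ Γ, ∀ v ∈ V, v * γ ∈ V) : RightFG Γ V := by
  obtain ⟨T', hT'⟩ := exists_finset_span_of_stable (rightMul ι) S T V hV
    (fun s hs v hv => hΓ _ (hS s hs) v hv)
  refine ⟨T', le_antisymm ?_ ?_⟩
  · conv_lhs => rw [hT']
    rw [Submodule.span_le]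
    rintro _ ⟨s, hs, t, ht, rfl⟩
    exact Submodule.mul_mem_mul (Submodule.subset_span ht) (hS s hs)
  · rw [Submodule.mul_le]
    intro v hv γ hγ
    refine hΓ γ hγ v ((Submodule.span_le (p := V)).2 ?_ hv)
    intro t ht
    rw [hT']
    exact Submodule.subset_span ⟨1, S.one_mem, t, ht, by simp⟩

variable {A : Type*} [Ring A] [Algebra k A]

theorem exists_finset_map_span_eq {f : A →ₐ[k] B} {V : Submodule k A} {T : Finset B}
    (hT : ∀ t ∈ T, t ∈ V.map f.toLinearMap) :
    ∃ T' : Finset A, (Submodule.span k (T' : Set A)).map f.toLinearMap =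
      Submodule.span k (T : Set B) := by
  classical
  choose! g hg using hT
  refine ⟨T.image g, ?_⟩
  rw [Submodule.map_span, Finset.coe_image, Set.image_image]
  congr 1
  exact (Set.image_congr fun t ht => (hg t ht).2).trans (Set.image_id _)

/-- The generators lie in the image of `V`, since `1 ∈ R`, so they can be pulled back; injectivity
then compares the two modules. -/
theorem LeftFG.of_map {f : A →ₐ[k] B} (hf : Function.Injective f) {R : Subalgebra k A}
    {V : Submodule k A} (h : LeftFG (R.map f) (V.map f.toLinearMap)) : LeftFG R V := by
  obtain ⟨T, hT⟩ := h
  obtain ⟨T', hT'⟩ := exists_finset_map_span_eq (f := f) (V := V) (T := T) (fun t ht => by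
    rw [hT, ← one_mul t]
    exact Submodule.mul_mem_mul (one_mem (R.map f)) (Submodule.subset_span ht))
  refine ⟨T', Submodule.map_injective_of_injective (f := f.toLinearMap) hf ?_⟩
  rw [Submodule.map_mul, hT', hT]
  rfl

theorem RightFG.of_map {f : A →ₐ[k] B} (hf : Function.Injective f) {R : Subalgebra k A}
    {V : Submodule k A} (h : RightFG (R.map f) (V.map f.toLinearMap)) : RightFG R V := by
  obtain ⟨T, hT⟩ := h
  obtain ⟨T', hT'⟩ := exists_finset_map_span_eq (f := f) (V := V) (T := T) (fun t ht => by
    rw [hT, ← mul_one t]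
    exact Submodule.mul_mem_mul (Submodule.subset_span ht) (one_mem (R.map f)))
  refine ⟨T', Submodule.map_injective_of_injective (f := f.toLinearMap) hf ?_⟩
  rw [Submodule.map_mul, hT', hT]
  rfl

end FiniteGeneration

/-! ### Artin's theorem for a finite group of automorphisms -/

section Artin

variable {k L : Type*} [Field k] [Field L] [Algebra k L]

/-- Only `G` has to be finite; `L / k` may have infinite degree, as it does for rational functions.
-/
theorem IntermediateField.finiteDimensional_fixedField_of_finite (G : Subgroup (L ≃ₐ[k] L))
    [Finite G] : FiniteDimensional (IntermediateField.fixedField G) L :=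
  inferInstanceAs (FiniteDimensional (FixedPoints.subfield G L) L)

theorem IntermediateField.isGalois_fixedField_of_finite (G : Subgroup (L ≃ₐ[k] L))
    [Finite G] : IsGalois (IntermediateField.fixedField G) L :=
  IsGalois.of_fixed_field L G

/-- By Artin every automorphism over the fixed field comes from `G`; the other inclusion is the
Galois connection. -/
theorem IntermediateField.fixingSubgroup_fixedField_of_finite (G : Subgroup (L ≃ₐ[k] L))
    [Finite G] : (IntermediateField.fixedField G).fixingSubgroup = G := by
  refine le_antisymm ?_ ((IntermediateField.le_iff_le _ _).mp le_rfl)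
  intro g hg
  obtain ⟨h, hh⟩ := FixedPoints.toAlgAut_surjective G L
    (IntermediateField.fixingSubgroupEquiv (IntermediateField.fixedField G) ⟨g, hg⟩)
  have : (h : L ≃ₐ[k] L) = g := by
    ext l
    exact DFunLike.congr_fun hh l
  exact this ▸ h.2

end Artin

/-! ### Supports and coefficients in the skew group ring -/

section Skew

variable {k : Type*} [Field k] {n : ℕ}

open WeylAlgebra SkewMonoidAlgebra

variable {L : Type*} [Field L] [Algebra k L]

/-- The elements of the skew group ring supported on a finite set. -/
def supportedOn (F : Finset (L ≃ₐ[k] L)) : Submodule k (SkewAut k L) where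
  carrier := {y | y.support ⊆ F}
  add_mem' := by
    classical
    exact fun {a b} ha hb => support_add.trans (Finset.union_subset ha hb)
  zero_mem' := by simp
  smul_mem' := fun c y hy g hg => hy (by
    rw [mem_support_iff] at hg ⊢
    intro h
    rw [coeff_smul, Finsupp.smul_apply, h, smul_zero] at hg
    exact hg rfl)

/-- Coefficient elements sit at the identity, so they do not enlarge supports. This, with its
right-hand version, confines `K T`, `T K` and `Γ u Γ` to a finite support. -/
theorem skewCoeff_mul_mem_supportedOn {F : Finset (L ≃ₐ[k] L)} (l : L) {y : SkewAut k L}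
    (hy : y ∈ supportedOn F) : skewCoeff k L l * y ∈ supportedOn F := fun g hg => hy (by
  rw [mem_support_iff, skewCoeff_apply, coeff_single_one_mul] at hg
  exact mem_support_iff.2 (right_ne_zero_of_mul hg))

theorem mul_skewCoeff_mem_supportedOn {F : Finset (L ≃ₐ[k] L)} (l : L) {y : SkewAut k L}
    (hy : y ∈ supportedOn F) : y * skewCoeff k L l ∈ supportedOn F := fun g hg => hy (by
  rw [mem_support_iff, skewCoeff_apply, coeff_mul_single_one] at hg
  exact mem_support_iff.2 (left_ne_zero_of_mul hg))

theorem eq_sum_single (y : SkewAut k L) : y = ∑ g ∈ y.support, single g (y.coeff g) := by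
  conv_lhs => rw [← SkewMonoidAlgebra.sum_single y]
  rfl

theorem skewConj_skewCoeff (g : L ≃ₐ[k] L) (l : L) :
    skewConj g (skewCoeff k L l) = skewCoeff k L (g l) := by
  rw [skewCoeff_apply, skewConj_single, skewCoeff_apply]; simp

theorem skewCoeff_injective : Function.Injective (skewCoeff k L) := fun a b h => by
  have := congrArg (fun y : SkewAut k L => y.coeff 1) h
  simpa [skewCoeff_apply, coeff_single_apply] using this

theorem skewCoeff_mem_invSkewMonoidRing {M : Submonoid (L ≃ₐ[k] L)} {G : Subgroup (L ≃ₐ[k] L)}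
    {l : L} : skewCoeff k L l ∈ invSkewMonoidRing M G ↔ ∀ g ∈ G, g l = l := by
  rw [mem_invSkewMonoidRing]
  constructor
  · intro h g hg
    apply skewCoeff_injective (k := k)
    rw [← skewConj_skewCoeff, h.2 g hg]
  · refine fun h => ⟨fun g hg => ?_, fun g hg => by rw [skewConj_skewCoeff, h g hg]⟩
    rw [Finset.mem_singleton.1 (support_single_subset hg)]
    exact M.one_mem

end Skew

/-! ### Symmetric denominators and symmetric polynomials -/

section Denominators

variable {k : Type*} [Field k] {n : ℕ}

open WeylAlgebra SkewMonoidAlgebra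

/-- Every nonzero polynomial divides a nonzero symmetric polynomial. -/
theorem exists_symmetric_multiple {q : RatField k n} (hq : q ∈ polyRange k n) (hq0 : q ≠ 0) :
    ∃ r ∈ polyRange k n, r * q ≠ 0 ∧ ∀ π, permRat k n π (r * q) = r * q := by
  classical
  refine ⟨∏ π ∈ Finset.univ.erase 1, permRat k n π q,
    prod_mem fun π _ => permRat_mem_polyRange π hq, ?_⟩
  have h : (∏ π ∈ Finset.univ.erase 1, permRat k n π q) * q = ∏ π, permRat k n π q := by
    rw [← Finset.prod_erase_mul Finset.univ _ (Finset.mem_univ 1), map_one, AlgEquiv.one_apply]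
  rw [h]
  refine ⟨Finset.prod_ne_zero_iff.2 fun π _ => by simpa using hq0, fun τ => ?_⟩
  rw [map_prod]
  exact Fintype.prod_equiv (Equiv.mulLeft τ) _ _ fun π => by
    simp [map_mul]

theorem exists_denominator (l : RatField k n) :
    ∃ q ∈ polyRange k n, q ≠ 0 ∧ q * l ∈ polyRange k n := by
  obtain ⟨p, q, hq, rfl⟩ := IsFractionRing.div_surjective (A := MvPolynomial (Fin n) k) l
  have hq0 : algebraMap _ (RatField k n) q ≠ 0 := by
    rw [Ne, map_eq_zero_iff _ (IsFractionRing.injective _ _)]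
    exact nonZeroDivisors.ne_zero hq
  refine ⟨_, algebraMap_mem_polyRange q, hq0, ?_⟩
  rw [mul_div_cancel₀ _ hq0]
  exact algebraMap_mem_polyRange p

theorem skewCoeff_mem_range {l : RatField k n} (hl : l ∈ polyRange k n) :
    skewCoeff k _ l ∈ (weylEmbedding k n).range := by
  have : skewCoeff k _ l ∈ (polyRange k n).map (skewCoeff k (RatField k n)) := ⟨l, hl, rfl⟩
  rw [← map_adjoin_t] at this
  obtain ⟨u, -, hu⟩ := this
  exact ⟨u, hu⟩

theorem single_mul_mem_range {a : Fin n → ℤ} {u : WeylAlgebra k n} {c p : RatField k n}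
    (hu : weylEmbedding k n u = single (shift k n (Multiplicative.ofAdd a)) c)
    (hp : p ∈ polyRange k n) :
    single (shift k n (Multiplicative.ofAdd a)) (p * c) ∈ (weylEmbedding k n).range := by
  have := mul_mem (skewCoeff_mem_range hp) (AlgHom.mem_range_self (weylEmbedding k n) u)
  rwa [hu, skewCoeff_apply, single_mul_single, one_mul, one_smul] at this

/-- Symmetric polynomials suffice to clear the denominators in the skew group ring. -/
theorem exists_symmetric_denominator {y : SkewAut k (RatField k n)}
    (hy : y ∈ skewMonoidRing (shiftMonoid k n 1)) :
    ∃ q ∈ polyRange k n, q ≠ 0 ∧ (∀ π, permRat k n π q = q) ∧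
      skewCoeff k _ q * y ∈ (weylEmbedding k n).range ∧
      y * skewCoeff k _ q ∈ (weylEmbedding k n).range := by
  have hsum : ∀ F : Finset (RatField k n ≃ₐ[k] RatField k n), (∀ g ∈ F, g ∈ shiftMonoid k n 1) →
      ∃ q ∈ polyRange k n, q ≠ 0 ∧ (∀ π, permRat k n π q = q) ∧
        skewCoeff k _ q * (∑ g ∈ F, single g (y.coeff g)) ∈ (weylEmbedding k n).range ∧
        (∑ g ∈ F, single g (y.coeff g)) * skewCoeff k _ q ∈ (weylEmbedding k n).range := by
    classical
    intro F
    induction F using Finset.induction_on with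
    | empty =>
      intro _
      exact ⟨1, one_mem _, one_ne_zero, fun π => map_one _, by simp, by simp⟩
    | insert g F hg ih =>
      intro hF
      obtain ⟨q, hq, hq0, hqπ, hql, hqr⟩ := ih fun g hg => hF g (Finset.mem_insert_of_mem hg)
      obtain ⟨a, rfl⟩ : ∃ a, g = shift k n (Multiplicative.ofAdd a) := by
        obtain ⟨a, ha⟩ := mem_shiftMonoid.1 (hF g (Finset.mem_insert_self _ _))
        exact ⟨a, by simpa using ha⟩
      obtain ⟨u, c, hc, hc0, hu⟩ := exists_weylEmbedding_eq_single (k := k) a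
      set s := shift k n (Multiplicative.ofAdd a) with hs
      -- The division by `c` is there because only polynomial multiples of `c` at `s` are known to
      -- lie in the image.
      obtain ⟨e, he, he0, hel⟩ := exists_denominator (y.coeff s / c)
      have hse : s⁻¹ e ∈ polyRange k n := by
        rw [hs, ← map_inv]; exact shift_mem_polyRange _ he
      have hse0 : s⁻¹ e ≠ 0 := by simpa using he0
      -- Right multiplication by `f` multiplies the coefficient at `s` by `s f`, so `e` should
      -- divide both `f` and `s f`; the factor `s⁻¹ e` takes care of the latter.
      obtain ⟨r, hr, hr0, hrπ⟩ := exists_symmetric_multiple (mul_mem he hse) (mul_ne_zero he0 hse0)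
      set f := r * (e * s⁻¹ e) with hf
      have hfm : f ∈ polyRange k n := mul_mem hr (mul_mem he hse)
      refine ⟨f * q, mul_mem hfm hq, mul_ne_zero hr0 hq0,
        fun π => by rw [map_mul, hrπ, hqπ], ?_, ?_⟩
      · rw [Finset.sum_insert hg, mul_add]
        refine add_mem ?_ ?_
        · rw [skewCoeff_apply, single_mul_single, one_mul, one_smul]
          have : f * q * y.coeff s = (q * r * s⁻¹ e * (e * (y.coeff s / c))) * c := by
            rw [hf]; field_simp
          rw [this]
          exact single_mul_mem_range hu (mul_mem (mul_mem (mul_mem hq hr) hse) hel)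
        · rw [map_mul, mul_assoc]
          exact mul_mem (skewCoeff_mem_range hfm) hql
      · rw [Finset.sum_insert hg, add_mul]
        refine add_mem ?_ ?_
        · rw [skewCoeff_apply, single_mul_single, mul_one, AlgEquiv.smul_def]
          have h1 : s (s⁻¹ e) = e := by rw [← AlgEquiv.mul_apply]; simp
          have : y.coeff s * s (f * q) = (s q * s r * s e * (e * (y.coeff s / c))) * c := by
            rw [hf]; simp only [map_mul, h1]; field_simp
          rw [this]
          exact single_mul_mem_range hu (mul_mem (mul_mem (mul_mem (shift_mem_polyRange _ hq)
            (shift_mem_polyRange _ hr)) (shift_mem_polyRange _ he)) hel)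
        · rw [mul_comm f q, map_mul, ← mul_assoc]
          exact mul_mem hqr (skewCoeff_mem_range hfm)
  have := hsum y.support hy
  rwa [← eq_sum_single y] at this

/-- The coefficient embedding of `k[t_1, …, t_n]`. -/
def polyCoeff : MvPolynomial (Fin n) k →ₐ[k] SkewAut k (RatField k n) :=
  (skewCoeff k (RatField k n)).comp (IsScalarTower.toAlgHom k _ _)

theorem polyCoeff_apply (p : MvPolynomial (Fin n) k) :
    polyCoeff p = skewCoeff k (RatField k n) (algebraMap _ _ p) := rfl

theorem weylEmbedding_mem_span_left {u : WeylAlgebra k n}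
    {F : Finset (RatField k n ≃ₐ[k] RatField k n)} (hF : weylEmbedding k n u ∈ supportedOn F)
    [DecidableEq (SkewAut k (RatField k n))] :
    weylEmbedding k n u ∈ Submodule.span k
      {b | ∃ q : MvPolynomial (Fin n) k, ∃ t ∈ F.image (fun g => single g (1 : RatField k n)),
        b = polyCoeff q * t} := by
  rw [eq_sum_single (weylEmbedding k n u)]
  refine Submodule.sum_mem _ fun g hg => Submodule.subset_span ?_
  obtain ⟨p, hp⟩ := mem_polyRange.1 (coeff_weylEmbedding_mem u g)
  refine ⟨p, _, Finset.mem_image_of_mem _ (hF hg), ?_⟩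
  rw [polyCoeff_apply, hp, skewCoeff_apply, single_mul_single]
  simp

/-- Moving a coefficient `l` to the right of `g` replaces it by `g⁻¹ l`, still a polynomial because
`g` is a shift. -/
theorem weylEmbedding_mem_span_right {u : WeylAlgebra k n}
    {F : Finset (RatField k n ≃ₐ[k] RatField k n)} (hF : weylEmbedding k n u ∈ supportedOn F)
    [DecidableEq (SkewAut k (RatField k n))] :
    weylEmbedding k n u ∈ Submodule.span k
      {b | ∃ q : MvPolynomial (Fin n) k, ∃ t ∈ F.image (fun g => single g (1 : RatField k n)),
        b = t * polyCoeff q} := by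
  rw [eq_sum_single (weylEmbedding k n u)]
  refine Submodule.sum_mem _ fun g hg => Submodule.subset_span ?_
  have hg' : g⁻¹ ((weylEmbedding k n u).coeff g) ∈ polyRange k n := by
    obtain ⟨a, rfl⟩ := exists_eq_shift hg
    rw [← map_inv]
    exact shift_mem_polyRange _ (coeff_weylEmbedding_mem u _)
  obtain ⟨p, hp⟩ := mem_polyRange.1 hg'
  refine ⟨p, _, Finset.mem_image_of_mem _ (hF hg), ?_⟩
  rw [polyCoeff_apply, hp, skewCoeff_apply, single_mul_single, AlgEquiv.smul_def,
    ← AlgEquiv.mul_apply]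
  simp

variable (k n) in
/-- The algebra generated by the elementary symmetric polynomials. -/
def esymmAlg : Subalgebra k (MvPolynomial (Fin n) k) :=
  Algebra.adjoin k (MvPolynomial.esymm (Fin n) k '' Set.Iic n)

instance : IsNoetherianRing (esymmAlg k n) :=
  isNoetherianRing_adjoin ((Set.finite_Iic n).image _)

instance : Module.Finite (esymmAlg k n) (MvPolynomial (Fin n) k) :=
  finite_of_isIntegral_X _ fun i => isIntegral_of_esymm_mem _ MvPolynomial.X (fun j hj => by
    rw [MvPolynomial.aeval_X_left_apply]
    exact Algebra.subset_adjoin ⟨j, by simpa using hj, rfl⟩) i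

theorem permRat_esymm {p : MvPolynomial (Fin n) k} (hp : p ∈ esymmAlg k n)
    (π : Equiv.Perm (Fin n)) :
    permRat k n π (algebraMap _ _ p) = algebraMap _ (RatField k n) p := by
  have h : MvPolynomial.renameEquiv k π p = p := by
    have hle : esymmAlg k n ≤ MvPolynomial.symmetricSubalgebra (Fin n) k := by
      rw [esymmAlg, Algebra.adjoin_le_iff]
      rintro _ ⟨j, -, rfl⟩
      exact MvPolynomial.esymm_isSymmetric _ _ _
    exact hle hp π
  exact (ratExtend_algebraMap _ p).trans (congrArg _ h)

end Denominators

/-! ### Galois rings and Galois orders from the description of `U` and `Γ` -/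

section Order

variable {k : Type*} [Field k] {n : ℕ}

open WeylAlgebra SkewMonoidAlgebra

variable {H : Subgroup (Equiv.Perm (Fin n))} {m : ℕ} {Γ U : Subalgebra k (SkewAut k (RatField k n))}

theorem mem_fixedField_permRat {l : RatField k n} :
    l ∈ IntermediateField.fixedField (H.map (permRat k n)) ↔ ∀ π ∈ H, permRat k n π l = l := by
  rw [IntermediateField.mem_fixedField_iff]
  simp

/-- A symmetric denominator turns an `H`-fixed fraction into an `H`-fixed polynomial, so the
fraction is a quotient of two elements of `Γ`. -/
theorem fracField_eq (hΓ : ∀ y, y ∈ Γ ↔ ∃ l ∈ polyRange k n,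
      (∀ π ∈ H, permRat k n π l = l) ∧ skewCoeff k _ l = y) :
    fracField Γ = IntermediateField.fixedField (H.map (permRat k n)) := by
  apply le_antisymm
  · rw [fracField, IntermediateField.adjoin_le_iff]
    intro l hl
    obtain ⟨l', -, h2, h3⟩ := (hΓ _).1 hl
    rw [← skewCoeff_injective h3]
    exact mem_fixedField_permRat.2 h2
  · intro l hl
    rw [mem_fixedField_permRat] at hl
    obtain ⟨e, he, he0, hel⟩ := exists_denominator l
    obtain ⟨r, hr, hr0, hrπ⟩ := exists_symmetric_multiple he he0
    have h1 : r * e ∈ fracField Γ := IntermediateField.subset_adjoin _ _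
      ((hΓ _).2 ⟨_, mul_mem hr he, fun π _ => hrπ π, rfl⟩)
    have h2 : r * e * l ∈ fracField Γ := IntermediateField.subset_adjoin _ _
      ((hΓ _).2 ⟨_, by rw [mul_assoc]; exact mul_mem hr hel,
        fun π hπ => by rw [map_mul, hrπ, hl π hπ], rfl⟩)
    have : l = (r * e)⁻¹ * (r * e * l) := by rw [← mul_assoc, inv_mul_cancel₀ hr0, one_mul]
    rw [this]
    exact mul_mem (inv_mem h1) h2

/-- Compare the constant terms of the images of `t_i`: `-b i` against `0`. This is what makes
restriction to `K` separate the shifts. -/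
theorem shift_eq_permRat [CharZero k] {b : Fin n → ℤ} {π : Equiv.Perm (Fin n)}
    (h : shift k n (Multiplicative.ofAdd b) = permRat k n π) : b = 0 := by
  ext i
  have h1 := DFunLike.congr_fun h (ratVar k n i)
  rw [shift_ratVar, permRat_ratVar,
    IsScalarTower.algebraMap_apply k (MvPolynomial (Fin n) k) (RatField k n), ratVar, ratVar,
    ← map_sub] at h1
  have h2 := congrArg (MvPolynomial.eval (0 : Fin n → k)) (IsFractionRing.injective _ _ h1)
  simpa using h2

theorem skewMonoidRing_shiftMonoid_le :
    skewMonoidRing (shiftMonoid k n m) ≤ skewMonoidRing (shiftMonoid k n 1) := by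
  intro y hy g hg
  obtain ⟨a, rfl⟩ := mem_shiftMonoid.1 (hy g hg)
  exact mem_shiftMonoid.2 ⟨(m : ℤ) • a, by simp⟩

/-- Multiplication by a symmetric polynomial preserves invariance, so clearing denominators moves an
element of the invariant skew ring into `U`, from either side; both spanning conditions follow. -/
theorem isGaloisRing_of_mem_iff [CharZero k]
    (hU : ∀ y, y ∈ U ↔ y ∈ (weylEmbedding k n).range ∧
      y ∈ invSkewMonoidRing (shiftMonoid k n m) (H.map (permRat k n)))
    (hΓ : ∀ y, y ∈ Γ ↔ ∃ l ∈ polyRange k n,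
      (∀ π ∈ H, permRat k n π l = l) ∧ skewCoeff k _ l = y)
    (hfg : U.FG) :
    IsGaloisRing (shiftMonoid k n m) (H.map (permRat k n)) Γ U := by
  have hfin : Finite (H.map (permRat k n)) :=
    (Set.toFinite ((permRat k n) '' (H : Set (Equiv.Perm (Fin n))))).to_subtype
  have hK := fracField_eq hΓ
  have hgroup : H.map (permRat k n) = (fracField Γ).fixingSubgroup := by
    rw [hK, IntermediateField.fixingSubgroup_fixedField_of_finite]
  have hinv : ∀ l, (∀ π ∈ H, permRat k n π l = l) → skewCoeff k _ l ∈
      invSkewMonoidRing (shiftMonoid k n m) (H.map (permRat k n)) := fun l hl => by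
    rw [skewCoeff_mem_invSkewMonoidRing]
    rintro _ ⟨π, hπ, rfl⟩
    exact hl π hπ
  have hbase : Γ ≤ U := by
    intro y hy
    obtain ⟨l, h1, h2, rfl⟩ := (hΓ y).1 hy
    exact (hU _).2 ⟨skewCoeff_mem_range h1, hinv l h2⟩
  have hle : U ≤ invSkewMonoidRing (shiftMonoid k n m) (H.map (permRat k n)) :=
    fun y hy => ((hU y).1 hy).2
  have hKinv : fracAlg Γ ≤ invSkewMonoidRing (shiftMonoid k n m) (H.map (permRat k n)) := by
    rintro _ ⟨l, hl, rfl⟩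
    have hl' : l ∈ fracField Γ := hl
    rw [hK, mem_fixedField_permRat] at hl'
    exact hinv l hl'
  have hden : ∀ y ∈ invSkewMonoidRing (shiftMonoid k n m) (H.map (permRat k n)),
      ∃ q : RatField k n, q ≠ 0 ∧ q ∈ fracField Γ ∧ skewCoeff k _ q * y ∈ U ∧
        y * skewCoeff k _ q ∈ U := by
    intro y hy
    obtain ⟨q, hq, hq0, hqπ, hl, hr⟩ := exists_symmetric_denominator
      (skewMonoidRing_shiftMonoid_le (mem_invSkewMonoidRing.1 hy).1)
    have hqi := hinv q fun π _ => hqπ π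
    exact ⟨q, hq0, by rw [hK, mem_fixedField_permRat]; exact fun π _ => hqπ π,
      (hU _).2 ⟨hl, mul_mem hqi hy⟩, (hU _).2 ⟨hr, mul_mem hy hqi⟩⟩
  refine ⟨?_, ?_, ?_, hgroup, ?_, ?_, hbase, hle, ?_, ?_, ?_⟩
  · intro y hy
    obtain ⟨l, -, -, rfl⟩ := (hΓ y).1 hy
    exact ⟨l, rfl⟩
  · rw [hK]; exact IntermediateField.finiteDimensional_fixedField_of_finite _
  · rw [hK]; exact IntermediateField.isGalois_fixedField_of_finite _
  · rintro _ ⟨π, -, rfl⟩ g hg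
    obtain ⟨a, rfl⟩ := mem_shiftMonoid.1 hg
    rw [permRat_conj_shift]
    exact mem_shiftMonoid.2 ⟨fun i => a (π⁻¹ i), rfl⟩
  · intro g hg g' hg' h
    -- This quotient fixes `K`, so it is both a permutation and a shift, hence trivial.
    have hmem : g⁻¹ * g' ∈ H.map (permRat k n) := by
      rw [hgroup, IntermediateField.mem_fixingSubgroup_iff]
      intro c hc
      rw [AlgEquiv.mul_apply, ← h c hc, ← AlgEquiv.mul_apply, inv_mul_cancel, AlgEquiv.one_apply]
    obtain ⟨π, -, hπ⟩ := hmem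
    obtain ⟨a, rfl⟩ := mem_shiftMonoid.1 hg
    obtain ⟨b, rfl⟩ := mem_shiftMonoid.1 hg'
    rw [← map_inv, ← map_mul, ← ofAdd_neg, ← ofAdd_add] at hπ
    have := shift_eq_permRat hπ.symm
    rw [neg_add_eq_zero] at this
    rw [this]
  · obtain ⟨S, hS⟩ := hfg
    refine ⟨S, le_antisymm ?_ ?_⟩
    · rw [← hS]; exact Algebra.adjoin_mono Set.subset_union_right
    · rw [Algebra.adjoin_le_iff]
      exact Set.union_subset hbase (hS ▸ Algebra.subset_adjoin)
  · apply le_antisymm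
    · rw [Submodule.mul_le]
      exact fun a ha b hb => Subalgebra.mul_mem _ (hKinv ha) (hle hb)
    · intro y hy
      obtain ⟨q, hq0, hqK, hl, -⟩ := hden y hy
      have : y = skewCoeff k _ q⁻¹ * (skewCoeff k _ q * y) := by
        rw [← mul_assoc, ← map_mul, inv_mul_cancel₀ hq0, map_one, one_mul]
      rw [this]
      exact Submodule.mul_mem_mul ⟨q⁻¹, (fracField Γ).inv_mem hqK, rfl⟩ hl
  · apply le_antisymm
    · rw [Submodule.mul_le]
      exact fun a ha b hb => Subalgebra.mul_mem _ (hle ha) (hKinv hb)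
    · intro y hy
      obtain ⟨q, hq0, hqK, -, hr⟩ := hden y hy
      have : y = (y * skewCoeff k _ q) * skewCoeff k _ q⁻¹ := by
        rw [mul_assoc, ← map_mul, mul_inv_cancel₀ hq0, map_one, mul_one]
      rw [this]
      exact Submodule.mul_mem_mul hr ⟨q⁻¹, (fracField Γ).inv_mem hqK, rfl⟩

/-- Symmetric polynomials are fixed whatever `H` is, so one noetherian algebra serves all the
groups. -/
theorem polyCoeff_esymmAlg_mem
    (hΓ : ∀ y, y ∈ Γ ↔ ∃ l ∈ polyRange k n,
      (∀ π ∈ H, permRat k n π l = l) ∧ skewCoeff k _ l = y)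
    {p : MvPolynomial (Fin n) k} (hp : p ∈ esymmAlg k n) :
    polyCoeff p ∈ Γ :=
  (hΓ _).2 ⟨_, algebraMap_mem_polyRange p, fun π _ => permRat_esymm hp π, rfl⟩

/-- Finite support and polynomial coefficients place `V` in a finitely generated `k[t_1, …,
t_n]`-module, which is noetherian over the symmetric polynomials. -/
theorem leftFG_of_supportedOn
    (hΓ : ∀ y, y ∈ Γ ↔ ∃ l ∈ polyRange k n,
      (∀ π ∈ H, permRat k n π l = l) ∧ skewCoeff k _ l = y)
    {F : Finset (RatField k n ≃ₐ[k] RatField k n)}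
    {V : Submodule k (SkewAut k (RatField k n))} (hF : V ≤ supportedOn F)
    (hV : ∀ v ∈ V, v ∈ (weylEmbedding k n).range) (hs : ∀ γ ∈ Γ, ∀ v ∈ V, γ * v ∈ V) :
    LeftFG Γ V := by
  classical
  refine leftFG_of_stable polyCoeff (esymmAlg k n) Γ (fun s hs => polyCoeff_esymmAlg_mem hΓ hs)
    (F.image fun g => single g (1 : RatField k n)) V ?_ hs
  intro v hv
  obtain ⟨u, rfl⟩ := hV v hv
  exact weylEmbedding_mem_span_left (hF hv)

theorem rightFG_of_supportedOn
    (hΓ : ∀ y, y ∈ Γ ↔ ∃ l ∈ polyRange k n,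
      (∀ π ∈ H, permRat k n π l = l) ∧ skewCoeff k _ l = y)
    {F : Finset (RatField k n ≃ₐ[k] RatField k n)}
    {V : Submodule k (SkewAut k (RatField k n))} (hF : V ≤ supportedOn F)
    (hV : ∀ v ∈ V, v ∈ (weylEmbedding k n).range) (hs : ∀ γ ∈ Γ, ∀ v ∈ V, v * γ ∈ V) :
    RightFG Γ V := by
  classical
  refine rightFG_of_stable polyCoeff (esymmAlg k n) Γ (fun s hs => polyCoeff_esymmAlg_mem hΓ hs)
    (F.image fun g => single g (1 : RatField k n)) V ?_ hs
  intro v hv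
  obtain ⟨u, rfl⟩ := hV v hv
  exact weylEmbedding_mem_span_right (hF hv)

theorem le_fracAlg {k L : Type*} [Field k] [Field L] [Algebra k L]
    {Γ : Subalgebra k (SkewAut k L)} (h : Γ ≤ (skewCoeff k L).range) : Γ ≤ fracAlg Γ := by
  intro y hy
  obtain ⟨l, rfl⟩ := h hy
  exact ⟨l, IntermediateField.subset_adjoin _ _ hy, rfl⟩

/-- A finite-dimensional `K`-space is supported on the union of the supports of its generators, so
its intersection with `U` has finite support and polynomial coefficients. -/
theorem isGaloisOrder_of_mem_iff [CharZero k]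
    (hU : ∀ y, y ∈ U ↔ y ∈ (weylEmbedding k n).range ∧
      y ∈ invSkewMonoidRing (shiftMonoid k n m) (H.map (permRat k n)))
    (hΓ : ∀ y, y ∈ Γ ↔ ∃ l ∈ polyRange k n,
      (∀ π ∈ H, permRat k n π l = l) ∧ skewCoeff k _ l = y)
    (hfg : U.FG) :
    IsGaloisOrder (shiftMonoid k n m) (H.map (permRat k n)) Γ U := by
  classical
  have hring := isGaloisRing_of_mem_iff hU hΓ hfg
  have hfrac := le_fracAlg hring.coeff
  have hsupp : ∀ T : Finset (SkewAut k (RatField k n)),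
      Submodule.span k (T : Set _) ≤ supportedOn (T.biUnion support) := by
    intro T
    rw [Submodule.span_le]
    exact fun t ht => Finset.subset_biUnion_of_mem support ht
  refine ⟨hring, ?_, ?_⟩
  · rintro V - ⟨T, hT⟩
    refine leftFG_of_supportedOn hΓ (F := T.biUnion support) ?_ (fun v hv => ((hU v).1 hv.2).1) ?_
    · refine inf_le_left.trans ?_
      rw [hT, Submodule.mul_le]
      rintro _ ⟨l, -, rfl⟩ v hv
      exact skewCoeff_mul_mem_supportedOn l (hsupp T hv)
    · rintro γ hγ v ⟨hv, hvU⟩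
      refine ⟨?_, U.mul_mem (hring.base_le hγ) hvU⟩
      -- `V = K T` is stable under `Γ ⊆ K` because `K K = K`.
      have hv' : v ∈ V := hv
      change γ * v ∈ V
      rw [hT] at hv' ⊢
      have := Submodule.mul_mem_mul (M := Subalgebra.toSubmodule (fracAlg Γ)) (hfrac hγ) hv'
      rwa [← mul_assoc, Subalgebra.isIdempotentElem_toSubmodule] at this
  · rintro V - ⟨T, hT⟩
    refine rightFG_of_supportedOn hΓ (F := T.biUnion support) ?_ (fun v hv => ((hU v).1 hv.2).1) ?_
    · refine inf_le_left.trans ?_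
      rw [hT, Submodule.mul_le]
      rintro v hv _ ⟨l, -, rfl⟩
      exact mul_skewCoeff_mem_supportedOn l (hsupp T hv)
    · rintro γ hγ v ⟨hv, hvU⟩
      refine ⟨?_, U.mul_mem hvU (hring.base_le hγ)⟩
      have hv' : v ∈ V := hv
      change v * γ ∈ V
      rw [hT] at hv' ⊢
      have := Submodule.mul_mem_mul (N := Subalgebra.toSubmodule (fracAlg Γ)) hv' (hfrac hγ)
      rwa [mul_assoc, Subalgebra.isIdempotentElem_toSubmodule] at this

end Order

/-! ### The three groups -/

section Invariants

variable {k : Type*} [Field k] {n : ℕ}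

open WeylAlgebra SkewMonoidAlgebra

theorem torusHom_normalOrder_powX {m : ℕ} {ζ : Fin n → kˣ} (hζ : ∀ i, ζ i ^ m = 1)
    (p : MvPolynomial (Fin n) k) :
    torusHom ζ (normalOrder k n (MvPolynomial.aeval (fun i => MvPolynomial.X (Sum.inl i) ^ m) p)) =
      normalOrder k n (MvPolynomial.aeval (fun i => MvPolynomial.X (Sum.inl i) ^ m) p) := by
  induction p using MvPolynomial.induction_on with
  | C c =>
    rw [MvPolynomial.aeval_C, MvPolynomial.algebraMap_eq, normalOrder_C, AlgHom.commutes]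
  | add p q hp hq => simp only [map_add, hp, hq]
  | mul_X p i hp =>
    have h : (((ζ i)⁻¹ : kˣ) : k) ^ m = 1 := by
      rw [← Units.val_pow_eq_pow_val, inv_pow, hζ, inv_one, Units.val_one]
    rw [map_mul, MvPolynomial.aeval_X, normalOrder_apply, bimod_mul_X_inl_pow, ← normalOrder_apply,
      map_mul, hp, map_pow, torusHom_x, smul_pow, h, one_smul]

theorem torusHom_normalOrder_powY {m : ℕ} {ζ : Fin n → kˣ} (hζ : ∀ i, ζ i ^ m = 1)
    (p : MvPolynomial (Fin n) k) :
    torusHom ζ (normalOrder k n (MvPolynomial.aeval (fun i => MvPolynomial.X (Sum.inr i) ^ m) p)) =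
      normalOrder k n (MvPolynomial.aeval (fun i => MvPolynomial.X (Sum.inr i) ^ m) p) := by
  induction p using MvPolynomial.induction_on with
  | C c =>
    rw [MvPolynomial.aeval_C, MvPolynomial.algebraMap_eq, normalOrder_C, AlgHom.commutes]
  | add p q hp hq => simp only [map_add, hp, hq]
  | mul_X p i hp =>
    have h : ((ζ i : kˣ) : k) ^ m = 1 := by
      rw [← Units.val_pow_eq_pow_val, hζ, Units.val_one]
    rw [map_mul, MvPolynomial.aeval_X, normalOrder_apply, bimod_mul_X_inr_pow, ← normalOrder_apply,
      map_mul, hp, map_pow, torusHom_d, smul_pow, h, one_smul]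

theorem permHom_normalOrder_powX (m : ℕ) (π : Equiv.Perm (Fin n)) (p : MvPolynomial (Fin n) k) :
    permHom π (normalOrder k n (MvPolynomial.aeval (fun i => MvPolynomial.X (Sum.inl i) ^ m) p)) =
      normalOrder k n (MvPolynomial.aeval (fun i => MvPolynomial.X (Sum.inl i) ^ m)
        (MvPolynomial.rename π p)) := by
  induction p using MvPolynomial.induction_on with
  | C c =>
    rw [MvPolynomial.rename_C, MvPolynomial.aeval_C, MvPolynomial.algebraMap_eq, normalOrder_C,
      AlgHom.commutes]
  | add p q hp hq => simp only [map_add, hp, hq]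
  | mul_X p i hp =>
    rw [map_mul (MvPolynomial.aeval _), map_mul (MvPolynomial.rename _), MvPolynomial.rename_X,
      map_mul (MvPolynomial.aeval _), MvPolynomial.aeval_X,
      MvPolynomial.aeval_X, normalOrder_apply, normalOrder_apply, bimod_mul_X_inl_pow,
      bimod_mul_X_inl_pow, ← normalOrder_apply, ← normalOrder_apply, map_mul, hp, map_pow, permHom_x]

theorem permHom_normalOrder_powY (m : ℕ) (π : Equiv.Perm (Fin n)) (p : MvPolynomial (Fin n) k) :
    permHom π (normalOrder k n (MvPolynomial.aeval (fun i => MvPolynomial.X (Sum.inr i) ^ m) p)) =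
      normalOrder k n (MvPolynomial.aeval (fun i => MvPolynomial.X (Sum.inr i) ^ m)
        (MvPolynomial.rename π p)) := by
  induction p using MvPolynomial.induction_on with
  | C c =>
    rw [MvPolynomial.rename_C, MvPolynomial.aeval_C, MvPolynomial.algebraMap_eq, normalOrder_C,
      AlgHom.commutes]
  | add p q hp hq => simp only [map_add, hp, hq]
  | mul_X p i hp =>
    rw [map_mul (MvPolynomial.aeval _), map_mul (MvPolynomial.rename _), MvPolynomial.rename_X,
      map_mul (MvPolynomial.aeval _), MvPolynomial.aeval_X,
      MvPolynomial.aeval_X, normalOrder_apply, normalOrder_apply, bimod_mul_X_inr_pow,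
      bimod_mul_X_inr_pow, ← normalOrder_apply, ← normalOrder_apply, map_mul, hp, map_pow, permHom_d]

theorem mem_weylInvariants {W : Type*} [Group W]
    {ρ : W →* (WeylAlgebra k n ≃ₐ[k] WeylAlgebra k n)} {u : WeylAlgebra k n} :
    u ∈ weylInvariants ρ ↔ ∀ w, ρ w u = u := by
  simp [weylInvariants, Algebra.mem_iInf, AlgHom.mem_equalizer]

/-- The symmetric functions of the `x_i^m` and of the `∂_i^m` are fixed by all of `G(m,1,n)`, so by
`hρ` they lie in the invariants of `ρ`, and `subalgebra_fg` applies. -/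
theorem weylInvariants_fg {W : Type*} [Group W]
    {ρ : W →* (WeylAlgebra k n ≃ₐ[k] WeylAlgebra k n)} {m : ℕ} (hm : 1 ≤ m)
    (hρ : ∀ u, (∀ ζ, cyclicAct k n m ζ u = u) → (∀ π, permHom π u = u) → u ∈ weylInvariants ρ) :
    (weylInvariants ρ).FG := by
  have hζ : ∀ (ζ : CyclicProduct k n m) i, (ζ i : kˣ) ^ m = 1 := fun ζ i => (ζ i).2
  refine subalgebra_fg _ hm (fun j => hρ _ (fun ζ => ?_) fun π => ?_)
    (fun j => hρ _ (fun ζ => ?_) fun π => ?_)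
  · exact torusHom_normalOrder_powX (hζ ζ) _
  · rw [esymmX, permHom_normalOrder_powX, MvPolynomial.rename_esymm]
  · exact torusHom_normalOrder_powY (hζ ζ) _
  · rw [esymmY, permHom_normalOrder_powY, MvPolynomial.rename_esymm]

/-- The invariants of `G_m^{⊗ n} ⋊ H`, for a group `H` of permutations. -/
theorem isHarishChandra_and_isGaloisOrder [IsAlgClosed k] [CharZero k] {W : Type*} [Group W]
    (ρ : W →* (WeylAlgebra k n ≃ₐ[k] WeylAlgebra k n)) {m : ℕ} (hm : 1 ≤ m)
    (H : Subgroup (Equiv.Perm (Fin n)))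
    (hρ : ∀ u, u ∈ weylInvariants ρ ↔
      (∀ ζ, cyclicAct k n m ζ u = u) ∧ ∀ π ∈ H, permHom π u = u) :
    IsHarishChandra (tInvariants ρ) (weylInvariants ρ) ∧
      IsGaloisOrder (shiftMonoid k n m) (H.map (permRat k n))
        ((tInvariants ρ).map (weylEmbedding k n)) ((weylInvariants ρ).map (weylEmbedding k n)) := by
  have hinv : ∀ u, u ∈ weylInvariants ρ ↔ weylEmbedding k n u ∈
      invSkewMonoidRing (shiftMonoid k n m) (H.map (permRat k n)) := fun u =>
    (hρ u).trans (isInvariant_iff hm H u)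
  have hU : ∀ y, y ∈ (weylInvariants ρ).map (weylEmbedding k n) ↔ y ∈ (weylEmbedding k n).range ∧
      y ∈ invSkewMonoidRing (shiftMonoid k n m) (H.map (permRat k n)) := by
    intro y
    constructor
    · rintro ⟨u, hu, rfl⟩
      exact ⟨⟨u, rfl⟩, (hinv u).1 hu⟩
    · rintro ⟨⟨u, rfl⟩, hu⟩
      exact ⟨u, (hinv u).2 hu, rfl⟩
  have hΓ : ∀ y, y ∈ (tInvariants ρ).map (weylEmbedding k n) ↔ ∃ l ∈ polyRange k n,
      (∀ π ∈ H, permRat k n π l = l) ∧ skewCoeff k _ l = y := by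
    have hperm : ∀ l, skewCoeff k _ l ∈ invSkewMonoidRing (shiftMonoid k n m)
        (H.map (permRat k n)) ↔ ∀ π ∈ H, permRat k n π l = l := by
      intro l
      rw [skewCoeff_mem_invSkewMonoidRing]
      simp
    intro y
    constructor
    · rintro ⟨u, ⟨hu, hu'⟩, rfl⟩
      have h1 : weylEmbedding k n u ∈ (Algebra.adjoin k (Set.range (t k))).map (weylEmbedding k n) :=
        ⟨u, hu, rfl⟩
      rw [map_adjoin_t] at h1
      obtain ⟨l, hl, hlu⟩ := h1
      have h2 := (hinv u).1 hu'
      have hlu' : skewCoeff k _ l = weylEmbedding k n u := hlu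
      rw [← hlu', hperm] at h2
      exact ⟨l, hl, h2, hlu⟩
    · rintro ⟨l, hl, hlπ, rfl⟩
      have h1 : skewCoeff k _ l ∈ (polyRange k n).map (skewCoeff k (RatField k n)) := ⟨l, hl, rfl⟩
      rw [← map_adjoin_t] at h1
      obtain ⟨u, hu, hul⟩ := h1
      have hul' : weylEmbedding k n u = skewCoeff k _ l := hul
      refine ⟨u, ⟨hu, (hinv u).2 ?_⟩, hul⟩
      rw [hul', hperm]
      exact hlπ
  have hfg : ((weylInvariants ρ).map (weylEmbedding k n)).FG :=
    (weylInvariants_fg hm fun u h1 h2 => (hρ u).2 ⟨h1, fun π _ => h2 π⟩).map _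
  refine ⟨?_, isGaloisOrder_of_mem_iff hU hΓ hfg⟩
  -- `Γ` consists of coefficients at the identity, so `Γ u Γ` stays over the support of `u`.
  have hsupp : ∀ u, (Subalgebra.toSubmodule (tInvariants ρ) * Submodule.span k {u} *
      Subalgebra.toSubmodule (tInvariants ρ)).map (weylEmbedding k n).toLinearMap ≤
      supportedOn (weylEmbedding k n u).support := by
    intro u
    rw [Submodule.map_le_iff_le_comap, Submodule.mul_le]
    intro v hv b hb
    obtain ⟨l, -, -, hl⟩ := (hΓ _).1 ⟨b, hb, rfl⟩
    have hl' : skewCoeff k _ l = weylEmbedding k n b := hl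
    rw [Submodule.mem_comap, AlgHom.toLinearMap_apply, map_mul, ← hl']
    apply mul_skewCoeff_mem_supportedOn
    suffices h : Subalgebra.toSubmodule (tInvariants ρ) * Submodule.span k {u} ≤
        (supportedOn (weylEmbedding k n u).support).comap (weylEmbedding k n).toLinearMap from h hv
    rw [Submodule.mul_le]
    intro c hc w hw
    obtain ⟨e, -, -, he⟩ := (hΓ _).1 ⟨c, hc, rfl⟩
    have he' : skewCoeff k _ e = weylEmbedding k n c := he
    obtain ⟨r, rfl⟩ := Submodule.mem_span_singleton.1 hw
    rw [Submodule.mem_comap, AlgHom.toLinearMap_apply, map_mul, ← he']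
    apply skewCoeff_mul_mem_supportedOn
    rw [map_smul]
    exact Submodule.smul_mem _ r (fun g hg => hg)
  refine ⟨inf_le_right, ?_, fun u _ => LeftFG.of_map weylEmbedding_injective ?_,
    fun u _ => RightFG.of_map weylEmbedding_injective ?_⟩
  · intro a ha b hb
    obtain ⟨l, -, -, hl⟩ := (hΓ _).1 ⟨a, ha, rfl⟩
    obtain ⟨e, -, -, he⟩ := (hΓ _).1 ⟨b, hb, rfl⟩
    have hl' : skewCoeff k _ l = weylEmbedding k n a := hl
    have he' : skewCoeff k _ e = weylEmbedding k n b := he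
    apply weylEmbedding_injective
    rw [map_mul, map_mul, ← hl', ← he', ← map_mul, mul_comm, map_mul]
  · refine leftFG_of_supportedOn hΓ (hsupp u) (fun v hv => ?_) ?_
    · obtain ⟨w, -, rfl⟩ := hv
      exact ⟨w, rfl⟩
    · rintro _ ⟨c, hc, rfl⟩ _ ⟨w, hw, rfl⟩
      refine ⟨c * w, ?_, map_mul (weylEmbedding k n) c w⟩
      have := Submodule.mul_mem_mul (M := Subalgebra.toSubmodule (tInvariants ρ)) hc hw
      rwa [← mul_assoc, ← mul_assoc, Subalgebra.isIdempotentElem_toSubmodule] at this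
  · refine rightFG_of_supportedOn hΓ (hsupp u) (fun v hv => ?_) ?_
    · obtain ⟨w, -, rfl⟩ := hv
      exact ⟨w, rfl⟩
    · rintro _ ⟨c, hc, rfl⟩ _ ⟨w, hw, rfl⟩
      refine ⟨w * c, ?_, map_mul (weylEmbedding k n) w c⟩
      have := Submodule.mul_mem_mul (N := Subalgebra.toSubmodule (tInvariants ρ)) hw hc
      rwa [mul_assoc, Subalgebra.isIdempotentElem_toSubmodule] at this

theorem mem_weylInvariants_shephardTodd {m : ℕ} {u : WeylAlgebra k n} :
    u ∈ weylInvariants (shephardToddAct k n m) ↔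
      (∀ ζ, cyclicAct k n m ζ u = u) ∧ ∀ π ∈ (⊤ : Subgroup (Equiv.Perm (Fin n))),
        permHom π u = u := by
  rw [mem_weylInvariants]
  constructor
  · refine fun h => ⟨fun ζ => ?_, fun π _ => ?_⟩
    · have := h (SemidirectProduct.inl ζ)
      rwa [shephardToddAct, SemidirectProduct.lift_inl] at this
    · have := h (SemidirectProduct.inr π)
      rwa [shephardToddAct, SemidirectProduct.lift_inr] at this
  · rintro ⟨h1, h2⟩ w
    rw [← SemidirectProduct.inl_left_mul_inr_right w, map_mul, AlgEquiv.mul_apply, shephardToddAct,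
      SemidirectProduct.lift_inl, SemidirectProduct.lift_inr]
    have h3 : permAct w.right u = u := h2 w.right trivial
    rw [h3, h1]

theorem cyclicAct_one (ζ : CyclicProduct k n 1) : cyclicAct k n 1 ζ = 1 := by
  have : ζ = 1 := by
    ext i
    have h : (ζ i : kˣ) ^ 1 = 1 := (ζ i).2
    rw [pow_one] at h
    simp [h]
  rw [this, map_one]

/-- The uniform description is used with `m = 1`, where the cyclic part acts trivially. -/
theorem mem_weylInvariants_alternating {u : WeylAlgebra k n} :
    u ∈ weylInvariants (alternatingAct k n) ↔
      (∀ ζ, cyclicAct k n 1 ζ u = u) ∧ ∀ π ∈ alternatingGroup (Fin n), permHom π u = u := by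
  rw [mem_weylInvariants]
  constructor
  · exact fun h => ⟨fun ζ => by rw [cyclicAct_one, AlgEquiv.one_apply], fun π hπ => h ⟨π, hπ⟩⟩
  · exact fun h w => h.2 w w.2

theorem mem_weylInvariants_cyclic {m : ℕ} {u : WeylAlgebra k n} :
    u ∈ weylInvariants (cyclicAct k n m) ↔
      (∀ ζ, cyclicAct k n m ζ u = u) ∧ ∀ π ∈ (⊥ : Subgroup (Equiv.Perm (Fin n))),
        permHom π u = u := by
  rw [mem_weylInvariants]
  refine ⟨fun h => ⟨h, fun π hπ => ?_⟩, fun h => h.1⟩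
  rw [Subgroup.mem_bot.1 hπ, permHom_one]
  rfl

end Invariants

end

theorem theorem1p1 (k : Type*) [Field k] [IsAlgClosed k] [CharZero k] (n m : ℕ)
    (hn : 1 ≤ n) (hm : 1 ≤ m) :
    Function.Injective (weylEmbedding k n) ∧
    (weylEmbedding k n).range ≤ skewMonoidRing (shiftMonoid k n 1) ∧
    -- the group `G(m,1,n)`
    (IsHarishChandra (tInvariants (shephardToddAct k n m))
        (weylInvariants (shephardToddAct k n m)) ∧
      IsGaloisOrder (shiftMonoid k n m) (permRat k n).range
        ((tInvariants (shephardToddAct k n m)).map (weylEmbedding k n))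
        ((weylInvariants (shephardToddAct k n m)).map (weylEmbedding k n))) ∧
    -- the alternating group
    (IsHarishChandra (tInvariants (alternatingAct k n)) (weylInvariants (alternatingAct k n)) ∧
      IsGaloisOrder (shiftMonoid k n 1) ((alternatingGroup (Fin n)).map (permRat k n))
        ((tInvariants (alternatingAct k n)).map (weylEmbedding k n))
        ((weylInvariants (alternatingAct k n)).map (weylEmbedding k n))) ∧
    -- the product of `n` cyclic groups of order `m`
    (IsHarishChandra (tInvariants (cyclicAct k n m)) (weylInvariants (cyclicAct k n m)) ∧
      IsGaloisOrder (shiftMonoid k n m) ⊥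
        ((tInvariants (cyclicAct k n m)).map (weylEmbedding k n))
        ((weylInvariants (cyclicAct k n m)).map (weylEmbedding k n))) := by
  refine ⟨weylEmbedding_injective, ?_, ?_, ?_, ?_⟩
  · rintro _ ⟨u, rfl⟩
    exact weylEmbedding_mem_skewMonoidRing u
  · rw [MonoidHom.range_eq_map]
    exact isHarishChandra_and_isGaloisOrder _ hm _ fun _ => mem_weylInvariants_shephardTodd
  · exact isHarishChandra_and_isGaloisOrder _ le_rfl _ fun _ => mem_weylInvariants_alternating
  · rw [← Subgroup.map_bot (permRat k n)]
    exact isHarishChandra_and_isGaloisOrder _ hm _ fun _ => mem_weylInvariants_cyclic
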